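/- Let $\eta,\theta\in\mathbb R$ with $1+\eta\theta\ge 0$. For $0\le s<t$ and $x\in\mathbb R$ with $1+\eta x\ge 0$ let $Q_n(y)=Q_n(y;x,t,s)$ be the monic polynomials in $y$ given by $Q_0=1$, $Q_1=y-x$, $$yQ_1=Q_2+((t-s)\eta+\theta)Q_1+(t-s)(1+x\eta)Q_0,\qquad yQ_n=Q_{n+1}+(t\eta+\theta)Q_n+t(1+\eta\theta)Q_{n-1}\quad(n\ge 2).$$ (a) There is exactly one probability measure $P_{s,t}(x,dy)$ on $\mathbb R$ with all moments finite such that $\int Q_mQ_n\,P_{s,t}(x,dy)=0$ for all $m\ne n$. (b) There is a Markov process $(X_t)_{t\ge 0}$ with $X_0=0$ almost surely and transition probabilities $P_{s,t}(x,dy)$; that is, $\Pr(X_t\in A\mid\mathcal F_s)=P_{s,t}(X_s,A)$ almost surely for all $0\le s<t$ and Borel $A\subseteq\mathbb R$, where $\mathcal F_s=\sigma\{X_r:r\le s\}$. (c) Every such process is square integrable and, with $\mathcal G_{s,u}=\sigma\{X_r: r\in[0,s]\cup[u,\infty)\}$ and $\operatorname{Var}(X\mid\mathcal G)=E(X^2\mid\mathcal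 G)-(E(X\mid\mathcal G))^2$, satisfies * $E(X_t)=0$ and $E(X_tX_s)=\min\{t,s\}$ for all $s,t\ge 0$; * for all $0\le s<t<u$, almost surely, $$E(X_t\mid\mathcal G_{s,u})=\frac{u-t}{u-s}X_s+\frac{t-s}{u-s}X_u;$$ * for all $0\le s<t<u$, almost surely, $$\operatorname{Var}(X_t\mid\mathcal G_{s,u})=\frac{(u-t)(t-s)}{u}\left(1+\eta\,\frac{uX_s-sX_u}{u-s}+\theta\,\frac{X_u-X_s}{u-s}+\frac{(X_u-X_s)(sX_u-uX_s)}{(u-s)^2}\right).$$ -/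

import Mathlib

open MeasureTheory Polynomial
open scoped NNReal

/-- The monic polynomials `Q_n(y; x, t, s)`, as polynomials in `y`, given by `Q_0 = 1`,
`Q_1 = y - x`,
`y Q_1 = Q_2 + ((t - s) η + θ) Q_1 + (t - s) (1 + x η) Q_0`, and
`y Q_n = Q_{n+1} + (t η + θ) Q_n + t (1 + η θ) Q_{n-1}` for `n ≥ 2`. -/
noncomputable def bpQ (η θ s t x : ℝ) : ℕ → ℝ[X]
  | 0 => 1
  | 1 => X - C x
  | 2 => (X - C ((t - s) * η + θ)) * (X - C x) - C ((t - s) * (1 + x * η))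
  | n + 3 => (X - C (t * η + θ)) * bpQ η θ s t x (n + 2)
      - C (t * (1 + η * θ)) * bpQ η θ s t x (n + 1)

/-- The measure `ν` has all moments, and the polynomials `Q n` are orthogonal with respect to it.
The squared norms `∫ Q n ^ 2 ∂ν` are allowed to vanish, as they do when `ν` has finite support. -/
structure MakesOrthogonal (Q : ℕ → ℝ[X]) (ν : Measure ℝ) : Prop where
  integrable_pow : ∀ n : ℕ, Integrable (fun y : ℝ => y ^ n) ν
  orthogonal : ∀ m n : ℕ, m ≠ n → ∫ y, (Q m).eval y * (Q n).eval y ∂ν = 0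

open Classical in
/-- The transition probability `P_{s,t}(x, dy)`: the probability measure that makes the
polynomials `Q_n(y; x, t, s)` orthogonal, and the zero measure if there is none. -/
noncomputable def bpTransition (η θ s t x : ℝ) : Measure ℝ :=
  if h : ∃ ν : Measure ℝ, IsProbabilityMeasure ν ∧ MakesOrthogonal (bpQ η θ s t x) ν
  then h.choose else 0

/-- The σ-field `σ {X_r : r ∈ T}`. -/
abbrev sigmaOn {Ω : Type*} (X : ℝ≥0 → Ω → ℝ) (T : Set ℝ≥0) : MeasurableSpace Ω :=
  ⨆ r ∈ T, MeasurableSpace.comap (X r) inferInstance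

/-- The past `F_s = σ {X_r : r ∈ [0, s]}`. -/
abbrev pastField {Ω : Type*} (X : ℝ≥0 → Ω → ℝ) (s : ℝ≥0) : MeasurableSpace Ω :=
  sigmaOn X (Set.Iic s)

/-- The past and the future, `G_{s,u} = σ {X_r : r ∈ [0, s] ∪ [u, ∞)}`. -/
abbrev outerField {Ω : Type*} (X : ℝ≥0 → Ω → ℝ) (s u : ℝ≥0) : MeasurableSpace Ω :=
  sigmaOn X (Set.Iic s ∪ Set.Ici u)

/-- `X` is a Markov process with `X_0 = 0` and transition probabilities `P_{s,t}(x, dy)`: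
`Pr(X_t ∈ A | F_s) = P_{s,t}(X_s, A)` almost surely, for `0 ≤ s < t` and Borel sets `A`. -/
structure IsFreeBiPoisson (η θ : ℝ) {Ω : Type*} [MeasurableSpace Ω] (μ : Measure Ω)
    (X : ℝ≥0 → Ω → ℝ) : Prop where
  measurable : ∀ t, Measurable (X t)
  start : ∀ᵐ ω ∂μ, X 0 ω = 0
  markov : ∀ s t : ℝ≥0, s < t → ∀ A : Set ℝ, MeasurableSet A →
    μ[(X t ⁻¹' A).indicator (fun _ => (1 : ℝ)) | pastField X s]
      =ᵐ[μ] fun ω => (bpTransition η θ s t (X s ω)).real A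

/-!
Write `M_n(y; t)` for the polynomials `Q_n(y; 0, t, 0)` that are orthogonal for the law of `X_t`.
Everything rests on one identity between generating functions (`bpM_connection`): it expands
`M_n(y; t)` in the `Q_k(y; x, t, s)` with coefficients `M_j(x; s)`. A probability measure that
makes the `Q_k(·; x, t, s)` orthogonal integrates all of them except `Q_0` to zero, so that it
integrates `M_n(·; t)` to `M_n(x; s)` (`MakesOrthogonal.integral_bpM`). In other words, every
`M_n(X_t; t)` is a martingale. Since all measures in sight have bounded support, they are
determined by their moments (`measure_eq_of_moments`), and conversely the martingale property pins
down the transition probabilities.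

*The transition probabilities.* Existence is the spectral theorem for the Jacobi operator `J` of
the `Q_n`, a bounded self-adjoint operator on `ℓ²(ℕ)` with `Q_n(J) e₀` a multiple of `e_n`
(`exists_makesOrthogonal`). The process can be iterated only if `P_{s,t}(x, ·)` stays on the
domain `1 + y η ≥ 0`. This holds because `1 + η J = (D + η S) (D + η S)^*` for a diagonal operator
`D` and a weighted shift `S` (`one_add_smul_jacobiOp`). The spectral measure may have finite
support; the argument does not divide by the squared norms of the `Q_n`, so that this case needs
no special treatment.

*Conditional moments.* The three-term recurrence says that multiplication by `y` acts on the
sequence `(M_n(y; t))_n` as a Jacobi matrix `A + t B`, affine in `t`. Testing against a variable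
from the past of `s` and against `M_n(X_u; u)`, and using the martingale property, turns products
of coordinates of `X` into products of these matrices. Affinity in `t` gives the conditional mean
(`IsPolyMartingale.condExp_linear`), and the relation `A B = 1 + η A + θ B` gives the conditional
second moment (`bpJacobi_quadratic`, `IsPolyMartingale.condExp_sq`). Such tests suffice: monomials
in the future of `u` condition to polynomials in `X_u`, and monomials in bounded coordinates
separate the `σ`-field they generate (`setIntegral_sigmaOn_eq_zero`).

*Existence of the process.* Finitely many times are handled by composing kernels. As `|X_t|` is
bounded for each `t`, the laws of these chains live on one compact space of paths, and a limit
along an ultrafilter on the finite sets of times satisfies the martingale identities for all times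
at once. By the characterization through moments, it is the process
(`IsPolyMartingale.isFreeBiPoisson`).
-/

/-! ### The polynomials and their connection formula -/

lemma bpQ_zero (η θ s t x : ℝ) : bpQ η θ s t x 0 = 1 := by rw [bpQ]
lemma bpQ_one (η θ s t x : ℝ) : bpQ η θ s t x 1 = X - C x := by rw [bpQ]
lemma bpQ_two (η θ s t x : ℝ) : bpQ η θ s t x 2 =
    (X - C ((t - s) * η + θ)) * (X - C x) - C ((t - s) * (1 + x * η)) := by rw [bpQ]
lemma bpQ_add_three (η θ s t x : ℝ) (n : ℕ) : bpQ η θ s t x (n + 3) =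
    (X - C (t * η + θ)) * bpQ η θ s t x (n + 2)
      - C (t * (1 + η * θ)) * bpQ η θ s t x (n + 1) := by rw [bpQ]

lemma monic_bpQ (η θ s t x : ℝ) (n : ℕ) :
    (bpQ η θ s t x n).Monic ∧ (bpQ η θ s t x n).natDegree = n := by
  have key : ∀ (a b : ℝ) (p q : ℝ[X]) (k : ℕ), p.Monic → p.natDegree = k + 1 →
      q.natDegree ≤ k → ((X - C a) * p - C b * q).Monic ∧
        ((X - C a) * p - C b * q).natDegree = k + 2 := by
    intro a b p q k hp hpk hq
    have h1 : ((X - C a) * p).Monic := (monic_X_sub_C a).mul hp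
    have h2 : ((X - C a) * p).natDegree = k + 2 := by
      rw [(monic_X_sub_C a).natDegree_mul hp, natDegree_X_sub_C, hpk]; ring
    have h3 : (C b * q).natDegree < ((X - C a) * p).natDegree := by
      have := natDegree_C_mul_le b q
      omega
    refine ⟨h1.sub_of_left (degree_lt_degree h3), ?_⟩
    rw [natDegree_sub_eq_left_of_natDegree_lt h3, h2]
  induction n using Nat.strong_induction_on with
  | _ n ih =>
    match n with
    | 0 => simp [bpQ_zero]
    | 1 => simp [bpQ_one, monic_X_sub_C]
    | 2 =>
      have := key ((t - s) * η + θ) ((t - s) * (1 + x * η)) (X - C x) 1 0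
        (monic_X_sub_C x) (by simp) (by simp)
      simpa [bpQ_two] using this
    | n + 3 =>
      rw [bpQ_add_three]
      exact key _ _ _ _ (n + 1) (ih (n + 2) (by omega)).1 (ih (n + 2) (by omega)).2
        (ih (n + 1) (by omega)).2.le

/-- A linear property of polynomials holds for all of them as soon as it holds for the `Q_n`. -/
lemma bpQ_induction (η θ s t x : ℝ) {P : ℝ[X] → Prop} (h0 : P 0)
    (hadd : ∀ p q, P p → P q → P (p + q)) (hsmul : ∀ (a : ℝ) p, P p → P (a • p))
    (hQ : ∀ n, P (bpQ η θ s t x n)) (p : ℝ[X]) : P p := by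
  let S : Polynomial.Sequence ℝ :=
    ⟨bpQ η θ s t x, fun n => by
      rw [degree_eq_natDegree (monic_bpQ η θ s t x n).1.ne_zero, (monic_bpQ η θ s t x n).2]⟩
  have hp : p ∈ Submodule.span ℝ (Set.range S) := by
    rw [S.span fun i => by
      rw [show (S i).leadingCoeff = 1 from (monic_bpQ η θ s t x i).1]; exact isUnit_one]
    trivial
  induction hp using Submodule.span_induction with
  | mem p hp => obtain ⟨n, rfl⟩ := hp; exact hQ n
  | zero => exact h0
  | add p q _ _ hp hq => exact hadd p q hp hq
  | smul a p _ hp => exact hsmul a p hp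

/-- The martingale polynomials `M_n(·; t) = Q_n(·; 0, t, 0)`: the orthogonal polynomials of the
law of `X_t`. -/
noncomputable abbrev bpM (η θ t : ℝ) : ℕ → ℝ[X] := bpQ η θ 0 t 0

/-- Generating function of the `Q_n`, with the denominator cleared. -/
lemma bpQ_generating (η θ s t x y : ℝ) :
    PowerSeries.mk (fun n => (bpQ η θ s t x n).eval y) *
      (1 + PowerSeries.C (t * η + θ - y) * PowerSeries.X
        + PowerSeries.C (t * (1 + η * θ)) * PowerSeries.X ^ 2)
    = 1 + PowerSeries.C (t * η + θ - x) * PowerSeries.X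
        + PowerSeries.C (s + s * η * y - t * η * x + t * η * θ) * PowerSeries.X ^ 2 := by
  ext n
  have e : ∀ f : PowerSeries ℝ, ∀ a b : ℝ, f * (1 + PowerSeries.C a * PowerSeries.X
        + PowerSeries.C b * PowerSeries.X ^ 2) =
      f + PowerSeries.C a * (f * PowerSeries.X) +
        PowerSeries.C b * (f * PowerSeries.X * PowerSeries.X) := by intros; ring
  obtain ⟨a, ha⟩ : ∃ a, a = t * η + θ - y := ⟨_, rfl⟩
  obtain ⟨b, hb⟩ : ∃ b, b = t * (1 + η * θ) := ⟨_, rfl⟩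
  obtain ⟨a', ha'⟩ : ∃ a', a' = t * η + θ - x := ⟨_, rfl⟩
  obtain ⟨b', hb'⟩ : ∃ b', b' = s + s * η * y - t * η * x + t * η * θ := ⟨_, rfl⟩
  rw [e, ← ha, ← hb, ← ha', ← hb']
  match n with
  | 0 => simp [bpQ_zero]
  | 1 =>
    simp [bpQ_zero, bpQ_one, PowerSeries.coeff_C_mul, PowerSeries.coeff_X_pow,
      PowerSeries.coeff_one, PowerSeries.coeff_succ_mul_X]
    rw [ha, ha']
    ring
  | 2 =>
    simp [bpQ_zero, bpQ_one, bpQ_two, PowerSeries.coeff_C_mul, PowerSeries.coeff_X_pow,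
      PowerSeries.coeff_one, PowerSeries.coeff_succ_mul_X]
    rw [ha, hb, hb']
    ring
  | n + 3 =>
    simp [bpQ_add_three, PowerSeries.coeff_C_mul, PowerSeries.coeff_X_pow,
      PowerSeries.coeff_one, PowerSeries.coeff_succ_mul_X]
    rw [ha, hb]
    ring

/-- Connection formula: expansion of the martingale polynomials at time `t` in the
`Q_k(·; x, t, s)`, with the martingale polynomials at time `s` as coefficients. -/
lemma bpM_connection (η θ s t x y : ℝ) (n : ℕ) :
    (bpM η θ t (n + 1)).eval y + s * η * (bpM η θ t n).eval y =
      s * η * (bpM η θ s n).eval x +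
      ∑ k ∈ Finset.HasAntidiagonal.antidiagonal (n + 1),
        (bpQ η θ s t x k.1).eval y * (bpM η θ s k.2).eval x := by
  set Ft := PowerSeries.mk (fun n => (bpM η θ t n).eval y) with hFt
  set Fs := PowerSeries.mk (fun n => (bpM η θ s n).eval x) with hFs
  set G := PowerSeries.mk (fun n => (bpQ η θ s t x n).eval y) with hG
  have h1 := bpQ_generating η θ 0 t 0 y
  have h2 := bpQ_generating η θ 0 s 0 x
  have h3 := bpQ_generating η θ s t x y
  rw [← hFt] at h1
  rw [← hFs] at h2
  rw [← hG] at h3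
  set Dt := (1 + PowerSeries.C (t * η + θ - y) * PowerSeries.X
        + PowerSeries.C (t * (1 + η * θ)) * PowerSeries.X ^ 2) with hDt
  set Ds := (1 + PowerSeries.C (s * η + θ - x) * PowerSeries.X
        + PowerSeries.C (s * (1 + η * θ)) * PowerSeries.X ^ 2) with hDs
  have hne : ∀ a b : ℝ, (1 + PowerSeries.C a * PowerSeries.X
        + PowerSeries.C b * PowerSeries.X ^ 2) ≠ 0 := by
    intro a b h
    have := congrArg (PowerSeries.constantCoeff (R := ℝ)) h
    simp at this
  have key : (1 + PowerSeries.C (s * η) * PowerSeries.X) * Ft =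
      (G + PowerSeries.C (s * η) * PowerSeries.X) * Fs := by
    refine mul_right_cancel₀ (mul_ne_zero (hne (t * η + θ - y) (t * (1 + η * θ)))
      (hne (s * η + θ - x) (s * (1 + η * θ)))) ?_
    rw [← hDt, ← hDs]
    calc _ = (1 + PowerSeries.C (s * η) * PowerSeries.X) * (Ft * Dt) * Ds := by ring
      _ = (G * Dt + PowerSeries.C (s * η) * PowerSeries.X * Dt) * (Fs * Ds) := by
        rw [h1, h2, h3, hDt, hDs]
        simp only [map_add, map_sub, map_mul, map_one, map_zero]
        ring
      _ = _ := by ring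
  have h := congrArg (PowerSeries.coeff (R := ℝ) (n + 1)) key
  have e1 : (1 + PowerSeries.C (s * η) * PowerSeries.X) * Ft =
    Ft + PowerSeries.C (s * η) * (Ft * PowerSeries.X) := by ring
  have e2 : (G + PowerSeries.C (s * η) * PowerSeries.X) * Fs =
    G * Fs + PowerSeries.C (s * η) * (Fs * PowerSeries.X) := by ring
  rw [e1, e2] at h
  simp only [map_add, PowerSeries.coeff_C_mul, PowerSeries.coeff_succ_mul_X] at h
  simp only [PowerSeries.coeff_mul, hFt, hFs, hG, PowerSeries.coeff_mk] at h
  linarith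

/-! ### Measures with bounded support are determined by their moments -/

lemma Integrable.polynomial_eval {ν : Measure ℝ} (h : ∀ n : ℕ, Integrable (fun y : ℝ => y ^ n) ν)
    (p : ℝ[X]) : Integrable (fun y => p.eval y) ν := by
  simp only [eval_eq_sum_range]
  exact integrable_finsetSum _ fun i _ => (h i).const_mul _

lemma integrable_pow_of_ae_abs_le {ν : Measure ℝ} [IsFiniteMeasure ν] {R : ℝ}
    (h : ∀ᵐ y ∂ν, |y| ≤ R) (n : ℕ) : Integrable (fun y : ℝ => y ^ n) ν := by
  refine Integrable.of_bound (by fun_prop) (R ^ n) ?_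
  filter_upwards [h] with y hy
  rw [norm_pow, Real.norm_eq_abs]
  exact pow_le_pow_left₀ (abs_nonneg y) hy n

/-- Equal even moments force the support bound of one measure on the other. -/
lemma ae_abs_le_of_moments_eq {ν₁ ν₂ : Measure ℝ} [IsFiniteMeasure ν₁] [IsFiniteMeasure ν₂]
    {R : ℝ} (hR : ∀ᵐ y ∂ν₁, |y| ≤ R) (h2 : ∀ n : ℕ, Integrable (fun y : ℝ => y ^ n) ν₂)
    (heq : ∀ n : ℕ, ∫ y, y ^ n ∂ν₁ = ∫ y, y ^ n ∂ν₂) : ∀ᵐ y ∂ν₂, |y| ≤ max R 0 := by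
  set R' := max R 0 with hR'
  have hR'0 : 0 ≤ R' := le_max_right _ _
  have hbd : ∀ r, R' < r → ν₂.real {y | r ≤ |y|} = 0 := by
    intro r hr
    have hr0 : 0 < r := hR'0.trans_lt hr
    have hn : ∀ n : ℕ, ν₂.real {y | r ≤ |y|} ≤ ((R' / r) ^ 2) ^ n * ν₁.real Set.univ := by
      intro n
      have hset : {y : ℝ | r ≤ |y|} ⊆ {y | r ^ (2 * n) ≤ y ^ (2 * n)} := by
        intro y hy
        have := pow_le_pow_left₀ hr0.le (show r ≤ |y| from hy) (2 * n)
        rwa [Even.pow_abs (even_two_mul n)] at this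
      have h1 : r ^ (2 * n) * ν₂.real {y | r ^ (2 * n) ≤ y ^ (2 * n)} ≤ ∫ y, y ^ (2 * n) ∂ν₂ :=
        mul_meas_ge_le_integral_of_nonneg
          (Filter.Eventually.of_forall fun y => (even_two_mul n).pow_nonneg y) (h2 _) _
      have h3 : ∫ y, y ^ (2 * n) ∂ν₁ ≤ R' ^ (2 * n) * ν₁.real Set.univ := by
        calc _ ≤ ∫ y, R' ^ (2 * n) ∂ν₁ := by
              refine integral_mono_ae (integrable_pow_of_ae_abs_le hR _) (integrable_const _) ?_
              filter_upwards [hR] with y hy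
              have := pow_le_pow_left₀ (abs_nonneg y) (hy.trans (le_max_left R 0)) (2 * n)
              rwa [Even.pow_abs (even_two_mul n)] at this
          _ = _ := by simp [mul_comm]
      have h4 : ν₂.real {y | r ≤ |y|} ≤ ν₂.real {y | r ^ (2 * n) ≤ y ^ (2 * n)} :=
        measureReal_mono hset
      have hrp : 0 < r ^ (2 * n) := by positivity
      rw [← pow_mul, div_pow, div_mul_eq_mul_div, le_div_iff₀ hrp, mul_comm]
      calc _ ≤ _ := mul_le_mul_of_nonneg_left h4 hrp.le
        _ ≤ _ := h1
        _ ≤ _ := by rw [← heq]; exact h3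
    have hlim : Filter.Tendsto (fun n : ℕ => ((R' / r) ^ 2) ^ n * ν₁.real Set.univ)
        Filter.atTop (nhds (0 * ν₁.real Set.univ)) := by
      refine (tendsto_pow_atTop_nhds_zero_of_lt_one (by positivity) ?_).mul_const _
      have : R' / r < 1 := (div_lt_one hr0).2 hr
      have : 0 ≤ R' / r := by positivity
      nlinarith
    rw [zero_mul] at hlim
    exact le_antisymm (ge_of_tendsto' hlim hn) measureReal_nonneg
  have hall : ∀ k : ℕ, ∀ᵐ y ∂ν₂, |y| < R' + 1 / ((k : ℝ) + 1) := by
    intro k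
    have := hbd (R' + 1 / ((k : ℝ) + 1)) (by linarith [Nat.one_div_pos_of_nat (α := ℝ) (n := k)])
    rw [measureReal_eq_zero_iff] at this
    rw [ae_iff]
    simpa using this
  filter_upwards [ae_all_iff.2 hall] with y hy
  refine le_of_forall_pos_lt_add fun ε hε => ?_
  obtain ⟨k, hk⟩ := exists_nat_one_div_lt hε
  exact (hy k).trans (by linarith)

/-- A finite measure with bounded support is the only one with its moments. -/
lemma measure_eq_of_moments {ν₁ ν₂ : Measure ℝ} [IsFiniteMeasure ν₁] [IsFiniteMeasure ν₂]
    {R : ℝ} (hR : ∀ᵐ y ∂ν₁, |y| ≤ R) (h2 : ∀ n : ℕ, Integrable (fun y : ℝ => y ^ n) ν₂)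
    (heq : ∀ n : ℕ, ∫ y, y ^ n ∂ν₁ = ∫ y, y ^ n ∂ν₂) : ν₁ = ν₂ := by
  set R' := max R 0 with hR'
  have hb1 : ∀ᵐ y ∂ν₁, |y| ≤ R' := hR.mono fun y hy => hy.trans (le_max_left _ _)
  have hb2 : ∀ᵐ y ∂ν₂, |y| ≤ R' := ae_abs_le_of_moments_eq hR h2 heq
  have h1 := integrable_pow_of_ae_abs_le hR
  have hpoly : ∀ p : ℝ[X], ∫ y, p.eval y ∂ν₁ = ∫ y, p.eval y ∂ν₂ := by
    intro p
    simp only [eval_eq_sum_range]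
    rw [integral_finsetSum _ fun i _ => (h1 i).const_mul _,
      integral_finsetSum _ fun i _ => (h2 i).const_mul _]
    simp only [integral_const_mul, heq]
  refine ext_of_forall_integral_eq_of_IsFiniteMeasure fun f => ?_
  refine eq_of_forall_dist_le fun ε hε => ?_
  rw [Real.dist_eq]
  set K := ν₁.real Set.univ + ν₂.real Set.univ + 1 with hK
  have hKpos : 0 < K := by positivity
  obtain ⟨p, hp⟩ := exists_polynomial_near_of_continuousOn (-R') R' f f.continuous.continuousOn
    (ε / K) (by positivity)
  have hdiff : ∀ (ν : Measure ℝ) [IsFiniteMeasure ν], (∀ n : ℕ, Integrable (fun y : ℝ => y ^ n) ν) →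
      (∀ᵐ y ∂ν, |y| ≤ R') → |∫ y, f y ∂ν - ∫ y, p.eval y ∂ν| ≤ ε / K * ν.real Set.univ := by
    intro ν _ hν hb
    rw [← integral_sub (f.integrable ν) (Integrable.polynomial_eval hν p)]
    rw [← Real.norm_eq_abs]
    refine norm_integral_le_of_norm_le_const ?_
    filter_upwards [hb] with y hy
    rw [Real.norm_eq_abs, abs_sub_comm]
    exact (hp y (abs_le.1 hy)).le
  have d1 := hdiff ν₁ h1 hb1
  have d2 := hdiff ν₂ h2 hb2
  rw [hpoly p] at d1
  have : ε / K * ν₁.real Set.univ + ε / K * ν₂.real Set.univ ≤ ε := by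
    rw [← mul_add, div_mul_eq_mul_div, div_le_iff₀ hKpos]
    nlinarith
  calc _ ≤ _ := abs_sub_le _ (∫ y, p.eval y ∂ν₂) _
    _ ≤ _ := by rw [abs_sub_comm _ (∫ y, f y ∂ν₂)]; linarith

/-- Moments may be tested on the `Q_n` instead of the powers. -/
lemma measure_eq_of_integral_bpQ (η θ s t x : ℝ) {ν₁ ν₂ : Measure ℝ} [IsFiniteMeasure ν₁]
    [IsFiniteMeasure ν₂] {R : ℝ} (hR : ∀ᵐ y ∂ν₁, |y| ≤ R)
    (h2 : ∀ n : ℕ, Integrable (fun y : ℝ => y ^ n) ν₂)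
    (heq : ∀ n : ℕ, ∫ y, (bpQ η θ s t x n).eval y ∂ν₁ = ∫ y, (bpQ η θ s t x n).eval y ∂ν₂) :
    ν₁ = ν₂ := by
  have i1 := Integrable.polynomial_eval (integrable_pow_of_ae_abs_le hR)
  have i2 := Integrable.polynomial_eval h2
  have hpoly : ∀ p : ℝ[X], ∫ y, p.eval y ∂ν₁ = ∫ y, p.eval y ∂ν₂ := by
    refine bpQ_induction η θ s t x (by simp) ?_ ?_ heq
    · intro p q hp hq
      simp only [eval_add]
      rw [integral_add (i1 p) (i1 q), integral_add (i2 p) (i2 q), hp, hq]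
    · intro a p hp
      simp only [eval_smul, smul_eq_mul, integral_const_mul, hp]
  exact measure_eq_of_moments hR h2 fun n => by simpa using hpoly (X ^ n)

/-- The measures that make the `Q_n(·; x, t, s)` orthogonal integrate the martingale polynomials at
time `t` to their values at time `s`. -/
lemma MakesOrthogonal.integral_bpM {η θ s t x : ℝ} {ν : Measure ℝ} [IsProbabilityMeasure ν]
    (h : MakesOrthogonal (bpQ η θ s t x) ν) (n : ℕ) :
    ∫ y, (bpM η θ t n).eval y ∂ν = (bpM η θ s n).eval x := by
  have hi := Integrable.polynomial_eval h.integrable_pow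
  have hQ : ∀ n, n ≠ 0 → ∫ y, (bpQ η θ s t x n).eval y ∂ν = 0 := by
    intro n hn
    simpa [bpQ_zero] using h.orthogonal n 0 hn
  induction n with
  | zero => simp [bpQ_zero]
  | succ n ih =>
    have key := integral_congr_ae (μ := ν)
      (Filter.Eventually.of_forall fun y => bpM_connection η θ s t x y n)
    rw [integral_add (hi _) ((hi _).const_mul _), integral_add (integrable_const _)
      (integrable_finsetSum _ fun k _ => (hi _).mul_const _), integral_const_mul, ih,
      integral_finsetSum _ fun k _ => (hi _).mul_const _] at key
    simp only [integral_mul_const] at key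
    rw [Finset.sum_eq_single (0, n + 1)] at key
    · simp [bpQ_zero] at key
      linarith
    · rintro ⟨i, j⟩ hij hne
      rw [hQ i, zero_mul]
      rintro rfl
      simp at hij
      exact hne (by simp [hij])
    · simp

/-! ### Spectral measures of bounded self-adjoint operators -/

section Spectral

open scoped InnerProductSpace

variable {H : Type*} [NormedAddCommGroup H] [InnerProductSpace ℂ H] [CompleteSpace H]

lemma aeval_eq_cfcHom {J : H →L[ℂ] H} (hJ : IsSelfAdjoint J) (p : ℝ[X]) :
    aeval J p = cfcHom hJ (p.toContinuousMapOn (spectrum ℝ J)) := by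
  have h : (aeval J : ℝ[X] →ₐ[ℝ] (H →L[ℂ] H)) =
      (cfcHom hJ : C(spectrum ℝ J, ℝ) →⋆ₐ[ℝ] (H →L[ℂ] H)).toAlgHom.comp
        (Polynomial.toContinuousMapOnAlgHom (spectrum ℝ J)) := by
    ext1
    simp only [aeval_X, AlgHom.comp_apply]
    refine (cfcHom_id (R := ℝ) hJ).symm.trans (congrArg (cfcHom hJ) ?_)
    ext y
    simp
  exact DFunLike.congr_fun h p

/-- The spectral measure of a bounded self-adjoint operator at a vector. -/
lemma exists_spectralMeasure {J : H →L[ℂ] H} (hJ : IsSelfAdjoint J) (v : H) :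
    ∃ ν : Measure ℝ, IsFiniteMeasure ν ∧ (∀ᵐ y ∂ν, y ∈ spectrum ℝ J) ∧
      ∀ p : ℝ[X], ∫ y, p.eval y ∂ν = (⟪v, aeval J p v⟫_ℂ).re := by
  let Φ : C(spectrum ℝ J, ℝ) →⋆ₐ[ℝ] (H →L[ℂ] H) := cfcHom hJ
  have hpos : ∀ f : C(spectrum ℝ J, ℝ), 0 ≤ f → 0 ≤ (⟪v, Φ f v⟫_ℂ).re := by
    intro f hf
    let g : C(spectrum ℝ J, ℝ) := ⟨fun y => Real.sqrt (f y), by fun_prop⟩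
    have hg : f = star g * g := by
      ext y
      simpa [g] using (Real.mul_self_sqrt (hf y)).symm
    rw [hg, map_mul, map_star, mul_apply_eq_comp, ContinuousLinearMap.star_eq_adjoint,
      ContinuousLinearMap.adjoint_inner_right]
    exact inner_self_nonneg (𝕜 := ℂ)
  let L : C(spectrum ℝ J, ℝ) →ₗ[ℝ] ℝ :=
    { toFun := fun f => (⟪v, Φ f v⟫_ℂ).re
      map_add' := fun f g => by simp
      map_smul' := fun c f => by simp [inner_smul_right_eq_smul] }
  let Λ : CompactlySupportedContinuousMap (spectrum ℝ J) ℝ →ₚ[ℝ] ℝ :=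
    PositiveLinearMap.mk₀
      { toFun := fun f => L f.toContinuousMap
        map_add' := fun f g => L.map_add _ _
        map_smul' := fun c f => L.map_smul _ _ }
      (fun f hf => hpos _ hf)
  let ρ := RealRMK.rieszMeasure Λ
  have hρ : ∀ f : C(spectrum ℝ J, ℝ), ∫ y, f y ∂ρ = (⟪v, Φ f v⟫_ℂ).re := by
    intro f
    exact RealRMK.integral_rieszMeasure Λ ⟨f, HasCompactSupport.of_compactSpace _⟩
  have hemb : MeasurableEmbedding (Subtype.val : spectrum ℝ J → ℝ) :=
    MeasurableEmbedding.subtype_coe (spectrum.isClosed J).measurableSet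
  refine ⟨ρ.map Subtype.val, inferInstance, ?_, fun p => ?_⟩
  · refine (ae_map_iff measurable_subtype_coe.aemeasurable
      (p := fun y => y ∈ spectrum ℝ J) (spectrum.isClosed J).measurableSet).2 ?_
    exact Filter.Eventually.of_forall fun y => y.2
  · rw [hemb.integral_map, aeval_eq_cfcHom hJ]
    exact hρ (p.toContinuousMapOn (spectrum ℝ J))

lemma inner_aeval_mul {J : H →L[ℂ] H} (hJ : IsSelfAdjoint J) (p q : ℝ[X]) (v : H) :
    ⟪v, aeval J (p * q) v⟫_ℂ = ⟪aeval J p v, aeval J q v⟫_ℂ := by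
  have hp : star (aeval J p) = aeval J p := by
    rw [aeval_eq_cfcHom hJ, ← map_star]
    congr 1
  rw [map_mul, mul_apply_eq_comp, ← ContinuousLinearMap.adjoint_inner_left,
    ← ContinuousLinearMap.star_eq_adjoint, hp]

end Spectral

/-! ### The Jacobi operator -/

section Jacobi

open scoped InnerProductSpace
open InnerProductSpace

/-- The Hilbert space `ℓ²(ℕ)`. It is not an abbreviation, so that its only real structure is the
one that comes from the complex one. -/
def EllTwo : Type := lp (fun _ : ℕ => ℂ) 2

noncomputable instance : NormedAddCommGroup EllTwo :=
  inferInstanceAs (NormedAddCommGroup (lp (fun _ : ℕ => ℂ) 2))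

noncomputable instance : InnerProductSpace ℂ EllTwo :=
  inferInstanceAs (InnerProductSpace ℂ (lp (fun _ : ℕ => ℂ) 2))

instance : CompleteSpace EllTwo :=
  inferInstanceAs (CompleteSpace (lp (fun _ : ℕ => ℂ) 2))

/-- The standard orthonormal basis of `ℓ²(ℕ)`. -/
noncomputable def ellBasis (n : ℕ) : EllTwo :=
  (lp.single 2 n (1 : ℂ) : lp (fun _ : ℕ => ℂ) 2)

lemma inner_ellBasis (n : ℕ) (f : lp (fun _ : ℕ => ℂ) 2) :
    (⟪ellBasis n, (f : EllTwo)⟫_ℂ : ℂ) = f n := by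
  refine (lp.inner_single_left (𝕜 := ℂ) n (1 : ℂ) f).trans ?_
  simp

lemma ellTwo_ext {f g : EllTwo} (h : ∀ n, ⟪ellBasis n, f⟫_ℂ = ⟪ellBasis n, g⟫_ℂ) : f = g := by
  refine lp.ext (E := fun _ : ℕ => ℂ) (p := 2) (funext fun n => ?_)
  exact (inner_ellBasis n f).symm.trans ((h n).trans (inner_ellBasis n g))

lemma inner_ellBasis_ellBasis (i j : ℕ) :
    ⟪ellBasis i, ellBasis j⟫_ℂ = if i = j then 1 else 0 := by
  refine (inner_ellBasis i (lp.single 2 j (1 : ℂ))).trans ?_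
  by_cases h : i = j
  · subst h; simp
  · simp [h, lp.single_apply]

lemma orthonormal_ellBasis : Orthonormal ℂ ellBasis :=
  orthonormal_iff_ite.2 inner_ellBasis_ellBasis

instance : Nontrivial EllTwo := ⟨ellBasis 0, 0, orthonormal_ellBasis.ne_zero 0⟩

/-- The unilateral shift on `ℓ²(ℕ)`. -/
noncomputable def ellShift : EllTwo →L[ℂ] EllTwo :=
  ((orthonormal_ellBasis.comp (fun n => n + 1)
    (add_left_injective 1)).orthogonalFamily).linearIsometry.toContinuousLinearMap

lemma ellShift_basis (n : ℕ) : ellShift (ellBasis n) = ellBasis (n + 1) := by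
  have := ((orthonormal_ellBasis.comp (fun n => n + 1)
    (add_left_injective 1)).orthogonalFamily).linearIsometry_apply_single (i := n) (1 : ℂ)
  exact this.trans (by simp)

lemma adjoint_ellShift_basis_zero : star ellShift (ellBasis 0) = 0 := by
  refine ellTwo_ext fun n => ?_
  rw [ContinuousLinearMap.star_eq_adjoint, ContinuousLinearMap.adjoint_inner_right,
    ellShift_basis, inner_ellBasis_ellBasis, inner_zero_right, if_neg n.succ_ne_zero]

lemma adjoint_ellShift_basis_succ (n : ℕ) : star ellShift (ellBasis (n + 1)) = ellBasis n := by
  refine ellTwo_ext fun k => ?_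
  rw [ContinuousLinearMap.star_eq_adjoint, ContinuousLinearMap.adjoint_inner_right,
    ellShift_basis, inner_ellBasis_ellBasis, inner_ellBasis_ellBasis]
  simp

/-- The weighted shift `e₀ ↦ a e₁`, `eₙ ↦ b eₙ₊₁` for `n ≥ 1`. -/
noncomputable def wShift (a b : ℝ) : EllTwo →L[ℂ] EllTwo :=
  (b : ℂ) • ellShift + ((a - b : ℝ) : ℂ) • rankOne ℂ (ellBasis 1) (ellBasis 0)

/-- The diagonal operator `e₀ ↦ a e₀`, `eₙ ↦ b eₙ` for `n ≥ 1`. -/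
noncomputable def wDiag (a b : ℝ) : EllTwo →L[ℂ] EllTwo :=
  (b : ℂ) • 1 + ((a - b : ℝ) : ℂ) • rankOne ℂ (ellBasis 0) (ellBasis 0)

lemma wShift_zero (a b : ℝ) : wShift a b (ellBasis 0) = (a : ℂ) • ellBasis 1 := by
  simp only [wShift, _root_.add_apply, _root_.smul_apply,
    ellShift_basis, rankOne_apply, inner_ellBasis_ellBasis, if_true]
  push_cast
  module

lemma wShift_succ (a b : ℝ) (n : ℕ) :
    wShift a b (ellBasis (n + 1)) = (b : ℂ) • ellBasis (n + 2) := by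
  simp only [wShift, _root_.add_apply, _root_.smul_apply,
    ellShift_basis, rankOne_apply, inner_ellBasis_ellBasis, (Nat.succ_ne_zero n).symm, if_false,
    zero_smul, smul_zero, add_zero]

lemma star_rankOne (f g : EllTwo) : star (rankOne ℂ f g) = rankOne ℂ g f := by
  rw [ContinuousLinearMap.star_eq_adjoint, adjoint_rankOne]

lemma star_wShift (a b : ℝ) : star (wShift a b) =
    (b : ℂ) • star ellShift + ((a - b : ℝ) : ℂ) • rankOne ℂ (ellBasis 0) (ellBasis 1) := by
  rw [wShift, star_add, star_smul, star_smul, star_rankOne]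
  simp only [RCLike.star_def, Complex.conj_ofReal]

lemma star_wShift_zero (a b : ℝ) : star (wShift a b) (ellBasis 0) = 0 := by
  simp only [star_wShift, _root_.add_apply, _root_.smul_apply,
    adjoint_ellShift_basis_zero, rankOne_apply, inner_ellBasis_ellBasis, one_ne_zero, if_false,
    zero_smul, smul_zero, add_zero]

lemma star_wShift_one (a b : ℝ) : star (wShift a b) (ellBasis 1) = (a : ℂ) • ellBasis 0 := by
  simp only [star_wShift, _root_.add_apply, _root_.smul_apply,
    adjoint_ellShift_basis_succ 0, rankOne_apply, inner_ellBasis_ellBasis, if_true]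
  push_cast
  module

lemma star_wShift_add_two (a b : ℝ) (n : ℕ) :
    star (wShift a b) (ellBasis (n + 2)) = (b : ℂ) • ellBasis (n + 1) := by
  have h : 1 ≠ n + 2 := by omega
  simp only [star_wShift, _root_.add_apply, _root_.smul_apply,
    adjoint_ellShift_basis_succ (n + 1), rankOne_apply, inner_ellBasis_ellBasis, h, if_false,
    zero_smul, smul_zero, add_zero]

lemma wDiag_zero (a b : ℝ) : wDiag a b (ellBasis 0) = (a : ℂ) • ellBasis 0 := by
  simp only [wDiag, _root_.add_apply, _root_.smul_apply,
    one_apply_eq_self, rankOne_apply, inner_ellBasis_ellBasis, if_true]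
  push_cast
  module

lemma wDiag_succ (a b : ℝ) (n : ℕ) :
    wDiag a b (ellBasis (n + 1)) = (b : ℂ) • ellBasis (n + 1) := by
  simp only [wDiag, _root_.add_apply, _root_.smul_apply,
    one_apply_eq_self, rankOne_apply, inner_ellBasis_ellBasis, (Nat.succ_ne_zero n).symm,
    if_false, zero_smul, smul_zero, add_zero]

lemma star_wDiag (a b : ℝ) : star (wDiag a b) = wDiag a b := by
  rw [wDiag, star_add, star_smul, star_smul, star_rankOne]
  simp only [RCLike.star_def, Complex.conj_ofReal, star_one]

lemma wDiag_mul_self (a b : ℝ) : wDiag a b * wDiag a b = wDiag (a ^ 2) (b ^ 2) := by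
  have h : rankOne ℂ (ellBasis 0) (ellBasis 0) * rankOne ℂ (ellBasis 0) (ellBasis 0) =
      rankOne ℂ (ellBasis 0) (ellBasis 0) := by
    ext1 f
    simp only [mul_apply_eq_comp, rankOne_apply, inner_smul_right, inner_ellBasis_ellBasis,
      if_true, mul_one]
  simp only [wDiag, mul_add, add_mul, smul_mul_assoc, mul_smul_comm, h, one_mul, mul_one]
  push_cast
  module

lemma one_add_smul_wDiag (η a b : ℝ) :
    1 + (η : ℂ) • wDiag a b = wDiag (1 + η * a) (1 + η * b) := by
  simp only [wDiag]
  push_cast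
  module

/-- The Jacobi operator of the polynomials `Q_n(·; x, t, s)`. It is written through a weighted shift
`S` and a diagonal operator `D` with `D² = 1 + η diag(x, θ, θ, …)`, in order that
`1 + η J = (D + η S) (D + η S)^*`. -/
noncomputable def jacobiOp (η θ s t x : ℝ) : EllTwo →L[ℂ] EllTwo :=
  wDiag x θ
    + wDiag √(1 + x * η) √(1 + η * θ) * star (wShift √(t - s) √t)
    + wShift √(t - s) √t * wDiag √(1 + x * η) √(1 + η * θ)
    + (η : ℂ) • (wShift √(t - s) √t * star (wShift √(t - s) √t))

lemma isSelfAdjoint_jacobiOp (η θ s t x : ℝ) : IsSelfAdjoint (jacobiOp η θ s t x) := by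
  rw [IsSelfAdjoint, jacobiOp]
  simp only [star_add, star_mul, star_star, star_smul, star_wDiag, RCLike.star_def,
    Complex.conj_ofReal]
  abel

lemma one_add_smul_jacobiOp {η θ s t x : ℝ} (hηθ : 0 ≤ 1 + η * θ) (hx : 0 ≤ 1 + x * η) :
    1 + (η : ℂ) • jacobiOp η θ s t x =
      (wDiag √(1 + x * η) √(1 + η * θ) + (η : ℂ) • wShift √(t - s) √t) *
      star (wDiag √(1 + x * η) √(1 + η * θ) + (η : ℂ) • wShift √(t - s) √t) := by
  have h := wDiag_mul_self √(1 + x * η) √(1 + η * θ)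
  rw [Real.sq_sqrt hx, Real.sq_sqrt hηθ, mul_comm x η, ← one_add_smul_wDiag η x θ,
    mul_comm η x] at h
  have hD := star_wDiag √(1 + x * η) √(1 + η * θ)
  have expand : ∀ (c : ℂ) (D S S' : EllTwo →L[ℂ] EllTwo),
      (D + c • S) * (D + c • S') = D * D + c • (D * S' + S * D + c • (S * S')) := by
    intro c D S S'
    simp only [add_mul, mul_add, smul_mul_assoc, mul_smul_comm, smul_add]
    abel
  rw [star_add, star_smul, hD, RCLike.star_def, Complex.conj_ofReal, expand, h, jacobiOp,
    add_assoc (1 : EllTwo →L[ℂ] EllTwo), ← smul_add]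
  congr 2
  abel

/-- The spectrum of the Jacobi operator lies in the domain, as `1 + η J` is of the form `T T^*`. -/
lemma spectrum_jacobiOp {η θ s t x : ℝ} (hηθ : 0 ≤ 1 + η * θ) (hx : 0 ≤ 1 + x * η) {y : ℝ}
    (hy : y ∈ spectrum ℝ (jacobiOp η θ s t x)) : 0 ≤ 1 + y * η := by
  have h1 : 0 ≤ aeval (jacobiOp η θ s t x) (C 1 + C η * X : ℝ[X]) := by
    have : aeval (jacobiOp η θ s t x) (C 1 + C η * X : ℝ[X]) =
        1 + (η : ℂ) • jacobiOp η θ s t x := by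
      simp only [map_add, map_mul, aeval_C, aeval_X, map_one, add_right_inj]
      rw [Algebra.algebraMap_eq_smul_one, smul_mul_assoc, one_mul]
      rfl
    rw [this, one_add_smul_jacobiOp hηθ hx]
    exact mul_star_self_nonneg _
  have h2 := spectrum_nonneg_of_nonneg h1
    (spectrum.subset_polynomial_aeval (jacobiOp η θ s t x) (C 1 + C η * X) ⟨y, hy, rfl⟩)
  simp only [eval_add, eval_C, eval_mul, eval_X] at h2
  rwa [mul_comm]

/-- The coefficients `cₙ` with `Q_n(J) e₀ = cₙ eₙ`. -/
noncomputable def jacobiCoeff (η θ s t x : ℝ) : ℕ → ℝ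
  | 0 => 1
  | n + 1 => √(t - s) * √(1 + x * η) * (√t * √(1 + η * θ)) ^ n

lemma aeval_jacobiOp_bpQ {η θ s t x : ℝ} (hηθ : 0 ≤ 1 + η * θ) (hx : 0 ≤ 1 + x * η)
    (hs : 0 ≤ s) (hst : s < t) (n : ℕ) :
    aeval (jacobiOp η θ s t x) (bpQ η θ s t x n) (ellBasis 0) =
      (jacobiCoeff η θ s t x n : ℂ) • ellBasis n := by
  obtain ⟨a, ha⟩ : ∃ a, a = √(t - s) := ⟨_, rfl⟩
  obtain ⟨b, hb⟩ : ∃ b, b = √t := ⟨_, rfl⟩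
  obtain ⟨α, hα⟩ : ∃ α, α = √(1 + x * η) := ⟨_, rfl⟩
  obtain ⟨β, hβ⟩ : ∃ β, β = √(1 + η * θ) := ⟨_, rfl⟩
  have ha2 : t - s = a ^ 2 := by rw [ha, Real.sq_sqrt (by linarith)]
  have hb2 : t = b ^ 2 := by rw [hb, Real.sq_sqrt (by linarith)]
  have hα2 : 1 + x * η = α ^ 2 := by rw [hα, Real.sq_sqrt hx]
  have hβ2 : 1 + η * θ = β ^ 2 := by rw [hβ, Real.sq_sqrt hηθ]
  have J0 : jacobiOp η θ s t x (ellBasis 0) =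
      (x : ℂ) • ellBasis 0 + ((α * a : ℝ) : ℂ) • ellBasis 1 := by
    simp only [jacobiOp, ← ha, ← hb, ← hα, ← hβ, _root_.add_apply,
      _root_.smul_apply, mul_apply_eq_comp, wDiag_zero,
      star_wShift_zero, map_zero, map_smul, wShift_zero]
    push_cast
    module
  have J1 : jacobiOp η θ s t x (ellBasis 1) = ((α * a : ℝ) : ℂ) • ellBasis 0 +
      ((a ^ 2 * η + θ : ℝ) : ℂ) • ellBasis 1 + ((β * b : ℝ) : ℂ) • ellBasis 2 := by
    simp only [jacobiOp, ← ha, ← hb, ← hα, ← hβ, _root_.add_apply,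
      _root_.smul_apply, mul_apply_eq_comp, wDiag_zero, wDiag_succ _ _ 0,
      star_wShift_one, map_smul, wShift_zero, wShift_succ _ _ 0, zero_add]
    push_cast
    module
  have J2 : ∀ n, jacobiOp η θ s t x (ellBasis (n + 2)) = ((β * b : ℝ) : ℂ) • ellBasis (n + 1) +
      ((b ^ 2 * η + θ : ℝ) : ℂ) • ellBasis (n + 2) + ((β * b : ℝ) : ℂ) • ellBasis (n + 3) := by
    intro n
    simp only [jacobiOp, ← ha, ← hb, ← hα, ← hβ, _root_.add_apply,
      _root_.smul_apply, mul_apply_eq_comp, wDiag_succ _ _ n, wDiag_succ _ _ (n + 1),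
      star_wShift_add_two, map_smul, wShift_succ _ _ n, wShift_succ _ _ (n + 1)]
    push_cast
    module
  have halg : ∀ (r : ℝ) (f : EllTwo),
      algebraMap ℝ (EllTwo →L[ℂ] EllTwo) r f = (r : ℂ) • f := by
    intro r f
    rw [Algebra.algebraMap_eq_smul_one]
    rfl
  have hc : ∀ n, jacobiCoeff η θ s t x (n + 1) = a * α * (b * β) ^ n := by
    intro n
    rw [jacobiCoeff, ha, hb, hα, hβ]
  induction n using Nat.strong_induction_on with
  | _ n ih =>
    match n with
    | 0 => simp [bpQ_zero, jacobiCoeff]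
    | 1 =>
      rw [hc 0, bpQ_one]
      simp only [map_sub, aeval_X, aeval_C, _root_.sub_apply, halg, J0, pow_zero]
      push_cast
      module
    | 2 =>
      rw [hc 1, bpQ_two, ha2, hα2]
      simp only [map_sub, map_mul, aeval_X, aeval_C, _root_.sub_apply, halg,
        mul_apply_eq_comp]
      simp only [J0, map_add, map_smul, J1]
      push_cast
      module
    | n + 3 =>
      have i1 := ih (n + 2) (by omega)
      have i2 := ih (n + 1) (by omega)
      have ht : t * η + θ = b ^ 2 * η + θ := by rw [← hb2]
      have ht' : t * (1 + η * θ) = b ^ 2 * β ^ 2 := by rw [← hb2, ← hβ2]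
      rw [bpQ_add_three, ht, ht']
      simp only [map_sub, map_mul, aeval_X, aeval_C, _root_.sub_apply, halg,
        mul_apply_eq_comp, i1, i2, map_smul, J2, hc]
      push_cast
      module

/-- The spectral measure of the Jacobi operator at `e₀` makes the `Q_n(·; x, t, s)` orthogonal. -/
lemma exists_makesOrthogonal {η θ s t x : ℝ} (hηθ : 0 ≤ 1 + η * θ) (hx : 0 ≤ 1 + x * η)
    (hs : 0 ≤ s) (hst : s < t) :
    ∃ ν : Measure ℝ, IsProbabilityMeasure ν ∧ MakesOrthogonal (bpQ η θ s t x) ν ∧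
      (∀ᵐ y ∂ν, 0 ≤ 1 + y * η) ∧ ∀ᵐ y ∂ν, |y| ≤ ‖jacobiOp η θ s t x‖ := by
  have hJ := isSelfAdjoint_jacobiOp η θ s t x
  obtain ⟨ν, hfin, hsupp, hν⟩ := exists_spectralMeasure hJ (ellBasis 0)
  have hbd : ∀ᵐ y ∂ν, |y| ≤ ‖jacobiOp η θ s t x‖ := by
    filter_upwards [hsupp] with y hy
    simpa using spectrum.norm_le_norm_of_mem hy
  refine ⟨ν, ⟨?_⟩, ⟨integrable_pow_of_ae_abs_le hbd, fun m n hmn => ?_⟩,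
    hsupp.mono fun y hy => spectrum_jacobiOp hηθ hx hy, hbd⟩
  · have h := hν 1
    simp only [eval_one, integral_const, smul_eq_mul, mul_one, map_one, one_apply_eq_self,
      inner_ellBasis_ellBasis, if_true, Complex.one_re] at h
    rw [measureReal_def, ENNReal.toReal_eq_one_iff] at h
    exact h
  · have h := hν (bpQ η θ s t x m * bpQ η θ s t x n)
    rw [inner_aeval_mul hJ, aeval_jacobiOp_bpQ hηθ hx hs hst, aeval_jacobiOp_bpQ hηθ hx hs hst,
      inner_smul_left, inner_smul_right, inner_ellBasis_ellBasis, if_neg hmn] at h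
    simpa using h

lemma continuous_jacobiOp (η θ s t : ℝ) : Continuous (jacobiOp η θ s t) := by
  unfold jacobiOp wDiag
  fun_prop

end Jacobi

/-! ### The transition probabilities -/

section Transition

variable {η θ s t x : ℝ}

lemma makesOrthogonal_unique {ν₁ ν₂ : Measure ℝ} [IsProbabilityMeasure ν₁]
    [IsProbabilityMeasure ν₂] {R : ℝ} (hR : ∀ᵐ y ∂ν₁, |y| ≤ R)
    (h₁ : MakesOrthogonal (bpQ η θ s t x) ν₁) (h₂ : MakesOrthogonal (bpQ η θ s t x) ν₂) :
    ν₁ = ν₂ := by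
  refine measure_eq_of_integral_bpQ η θ s t x hR h₂.integrable_pow fun n => ?_
  match n with
  | 0 => simp [bpQ_zero]
  | n + 1 =>
    have e₁ := h₁.orthogonal (n + 1) 0 n.succ_ne_zero
    have e₂ := h₂.orthogonal (n + 1) 0 n.succ_ne_zero
    simp only [bpQ_zero, eval_one, mul_one] at e₁ e₂
    rw [e₁, e₂]

lemma existsUnique_makesOrthogonal (hηθ : 0 ≤ 1 + η * θ) (hs : 0 ≤ s) (hst : s < t)
    (hx : 0 ≤ 1 + x * η) :
    ∃! ν : Measure ℝ, IsProbabilityMeasure ν ∧ MakesOrthogonal (bpQ η θ s t x) ν := by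
  obtain ⟨ν, hν, horth, -, hbd⟩ := exists_makesOrthogonal hηθ hx hs hst
  refine ⟨ν, ⟨hν, horth⟩, fun ν' ⟨hν', horth'⟩ => ?_⟩
  exact (makesOrthogonal_unique hbd horth horth').symm

lemma bpTransition_spec (hηθ : 0 ≤ 1 + η * θ) (hs : 0 ≤ s) (hst : s < t)
    (hx : 0 ≤ 1 + x * η) :
    IsProbabilityMeasure (bpTransition η θ s t x) ∧
      MakesOrthogonal (bpQ η θ s t x) (bpTransition η θ s t x) := by
  have h := (existsUnique_makesOrthogonal hηθ hs hst hx).exists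
  rw [bpTransition, dif_pos h]
  exact h.choose_spec

lemma bpTransition_support (hηθ : 0 ≤ 1 + η * θ) (hs : 0 ≤ s) (hst : s < t)
    (hx : 0 ≤ 1 + x * η) :
    (∀ᵐ y ∂(bpTransition η θ s t x), 0 ≤ 1 + y * η) ∧
      ∀ᵐ y ∂(bpTransition η θ s t x), |y| ≤ ‖jacobiOp η θ s t x‖ := by
  obtain ⟨ν, hν, horth, hdom, hbd⟩ := exists_makesOrthogonal hηθ hx hs hst
  obtain ⟨hP, horth'⟩ := bpTransition_spec hηθ hs hst hx
  rw [← makesOrthogonal_unique hbd horth horth']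
  exact ⟨hdom, hbd⟩

lemma integral_bpTransition_bpM (hηθ : 0 ≤ 1 + η * θ) (hs : 0 ≤ s) (hst : s < t)
    (hx : 0 ≤ 1 + x * η) (n : ℕ) :
    ∫ y, (bpM η θ t n).eval y ∂(bpTransition η θ s t x) = (bpM η θ s n).eval x := by
  obtain ⟨hP, horth⟩ := bpTransition_spec hηθ hs hst hx
  exact horth.integral_bpM n

/-- The transition operator maps polynomials to polynomials. -/
lemma exists_polynomial_integral_bpTransition (hηθ : 0 ≤ 1 + η * θ) (hs : 0 ≤ s) (hst : s < t)
    (p : ℝ[X]) : ∃ q : ℝ[X], ∀ x, 0 ≤ 1 + x * η →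
      ∫ y, p.eval y ∂(bpTransition η θ s t x) = q.eval x := by
  refine bpQ_induction η θ 0 t 0 (P := fun p => ∃ q : ℝ[X], ∀ x, 0 ≤ 1 + x * η →
      ∫ y, p.eval y ∂(bpTransition η θ s t x) = q.eval x) ⟨0, by simp⟩ ?_ ?_ ?_ p
  · intro p p' h h'
    obtain ⟨q, hq⟩ := h
    obtain ⟨q', hq'⟩ := h'
    refine ⟨q + q', fun x hx => ?_⟩
    obtain ⟨hP, horth⟩ := bpTransition_spec hηθ hs hst hx
    have hi := Integrable.polynomial_eval horth.integrable_pow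
    simp only [eval_add]
    rw [integral_add (hi p) (hi p'), hq x hx, hq' x hx]
  · intro a p h
    obtain ⟨q, hq⟩ := h
    refine ⟨a • q, fun x hx => ?_⟩
    simp only [eval_smul, smul_eq_mul, integral_const_mul, hq x hx]
  · exact fun n => ⟨bpM η θ s n, fun x hx => integral_bpTransition_bpM hηθ hs hst hx n⟩

/-- The support of `P_{s,t}(x, ·)` is bounded locally uniformly in `x`. -/
lemma exists_uniform_support_bound (hηθ : 0 ≤ 1 + η * θ) (hs : 0 ≤ s) (hst : s < t) (k : ℝ) :
    ∃ R, 0 ≤ R ∧ ∀ x, |x| ≤ k → 0 ≤ 1 + x * η → ∀ᵐ y ∂(bpTransition η θ s t x), |y| ≤ R := by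
  obtain ⟨R, hR⟩ := (isCompact_Icc (a := -k) (b := k)).exists_bound_of_continuousOn
    (continuous_jacobiOp η θ s t).continuousOn
  refine ⟨max R 0, le_max_right _ _, fun x hx hdom => ?_⟩
  filter_upwards [(bpTransition_support hηθ hs hst hdom).2] with y hy
  exact hy.trans ((hR x (abs_le.1 hx)).trans (le_max_left _ _))

end Transition

/-! ### The transition kernels -/

section TransitionKernel

open ProbabilityTheory Filter Topology
open scoped BoundedContinuousFunction ENNReal

variable {η θ s t : ℝ}

/-- The transition probabilities form a Markov kernel. Off the domain `1 + x η ≥ 0`, where they are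
not defined, the kernel has an arbitrary value. -/
lemma exists_transitionKernel (hηθ : 0 ≤ 1 + η * θ) (hs : 0 ≤ s) (hst : s < t) :
    ∃ κ : Kernel ℝ ℝ, IsMarkovKernel κ ∧
      ∀ x, 0 ≤ 1 + x * η → κ x = bpTransition η θ s t x := by
  classical
  let D : Set ℝ := {x | 0 ≤ 1 + x * η}
  have hD : MeasurableSet D := (isClosed_le continuous_const (by fun_prop)).measurableSet
  let κ : ℝ → Measure ℝ := fun x => if x ∈ D then bpTransition η θ s t x else Measure.dirac 0
  have hκD : ∀ x, x ∈ D → κ x = bpTransition η θ s t x := fun x hx => if_pos hx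
  have hκprob : ∀ x, IsProbabilityMeasure (κ x) := by
    intro x
    by_cases hx : x ∈ D
    · rw [hκD x hx]; exact (bpTransition_spec hηθ hs hst hx).1
    · rw [show κ x = Measure.dirac 0 from if_neg hx]; infer_instance
  choose R hR0 hR using fun k : ℕ => exists_uniform_support_bound (η := η) hηθ hs hst (k : ℝ)
  -- polynomial approximation of `f` on the supports makes `x ↦ ∫ f dP(x)` a limit of polynomials
  have hint : ∀ f : ℝ →ᵇ ℝ, Measurable fun x => ∫ y, f y ∂(κ x) := by
    intro f
    choose p hp using fun k : ℕ => exists_polynomial_near_of_continuousOn (-R k) (R k) f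
      f.continuous.continuousOn (1 / ((k : ℝ) + 1)) Nat.one_div_pos_of_nat
    choose q hq using fun k : ℕ =>
      exists_polynomial_integral_bpTransition (η := η) hηθ hs hst (p k)
    refine measurable_of_tendsto_metrizable
      (f := fun (k : ℕ) x => if x ∈ D then (q k).eval x else f 0)
      (fun k => Measurable.ite hD (q k).continuous.measurable measurable_const) ?_
    rw [tendsto_pi_nhds]
    intro x
    by_cases hx : x ∈ D
    · simp only [if_pos hx]
      obtain ⟨hP, horth⟩ := bpTransition_spec hηθ hs hst hx
      rw [hκD x hx, tendsto_iff_dist_tendsto_zero]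
      refine squeeze_zero' (Eventually.of_forall fun _ => dist_nonneg) ?_
        tendsto_one_div_add_atTop_nhds_zero_nat
      obtain ⟨N, hN⟩ := exists_nat_ge |x|
      filter_upwards [eventually_ge_atTop N] with k hk
      rw [← hq k x hx, Real.dist_eq,
        ← integral_sub (Integrable.polynomial_eval horth.integrable_pow _) (f.integrable _),
        ← Real.norm_eq_abs]
      refine (norm_integral_le_of_norm_le_const (C := 1 / ((k : ℝ) + 1)) ?_).trans (by simp)
      filter_upwards [hR k x (hN.trans (by exact_mod_cast hk)) hx] with y hy
      exact (hp k y (abs_le.1 hy)).le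
    · simp only [if_neg hx]
      rw [show κ x = Measure.dirac 0 from if_neg hx]
      simp
  have hlint : ∀ f : ℝ →ᵇ ℝ≥0, Measurable fun x => ∫⁻ y, f y ∂(κ x) := by
    intro f
    let g : ℝ →ᵇ ℝ := BoundedContinuousFunction.comp ((↑) : ℝ≥0 → ℝ)
      NNReal.isometry_coe.lipschitz f
    have : (fun x => ∫⁻ y, f y ∂(κ x)) = fun x => ENNReal.ofReal (∫ y, g y ∂(κ x)) := by
      ext x
      rw [ofReal_integral_eq_lintegral_ofReal (g.integrable _)
        (Eventually.of_forall fun y => (f y).2)]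
      refine lintegral_congr fun y => ?_
      exact (ENNReal.ofReal_coe_nnreal).symm
    rw [this]
    exact (hint g).ennreal_ofReal
  have hmeas : Measurable κ := by
    refine Measurable.measure_of_isPiSystem_of_isProbabilityMeasure
      (by rw [BorelSpace.measurable_eq (α := ℝ), borel_eq_generateFrom_isClosed])
      isPiSystem_isClosed fun F hF => ?_
    have hF' : IsClosed F := hF
    exact measurable_of_tendsto_metrizable (fun n => hlint (hF'.apprSeq n))
      (tendsto_pi_nhds.2 fun x => HasOuterApproxClosed.tendsto_lintegral_apprSeq hF' (κ x))
  exact ⟨⟨κ, hmeas⟩, ⟨hκprob⟩, hκD⟩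

end TransitionKernel

/-! ### Testing against monomials in the coordinates -/

section Monomials

open Filter

variable {Ω : Type*}

/-- The monomial `∏ X_i ^ n_i` in the coordinates of a process. -/
noncomputable def coordMonomial (X : ℝ≥0 → Ω → ℝ) (n : ℝ≥0 →₀ ℕ) (ω : Ω) : ℝ :=
  n.prod fun i k => X i ω ^ k

lemma coordMonomial_add (X : ℝ≥0 → Ω → ℝ) (n m : ℝ≥0 →₀ ℕ) (ω : Ω) :
    coordMonomial X (n + m) ω = coordMonomial X n ω * coordMonomial X m ω :=
  Finsupp.prod_add_index' (by simp) fun _ _ _ => pow_add _ _ _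

lemma coordMonomial_single (X : ℝ≥0 → Ω → ℝ) (i : ℝ≥0) (k : ℕ) (ω : Ω) :
    coordMonomial X (Finsupp.single i k) ω = X i ω ^ k := by
  simp [coordMonomial]

lemma coordMonomial_zero (X : ℝ≥0 → Ω → ℝ) (ω : Ω) : coordMonomial X 0 ω = 1 := by
  simp [coordMonomial]

lemma measurable_sigmaOn {X : ℝ≥0 → Ω → ℝ} {T : Set ℝ≥0} {i : ℝ≥0} (hi : i ∈ T) :
    Measurable[sigmaOn X T] (X i) :=
  Measurable.mono (comap_measurable (X i)) (le_iSup₂_of_le i hi le_rfl) le_rfl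

lemma sigmaOn_mono (X : ℝ≥0 → Ω → ℝ) {T T' : Set ℝ≥0} (h : T ⊆ T') :
    sigmaOn X T ≤ sigmaOn X T' :=
  biSup_mono fun _ hi => h hi

lemma measurable_coordMonomial {X : ℝ≥0 → Ω → ℝ} {T : Set ℝ≥0} {n : ℝ≥0 →₀ ℕ}
    (hn : (n.support : Set ℝ≥0) ⊆ T) : Measurable[sigmaOn X T] (coordMonomial X n) := by
  unfold coordMonomial Finsupp.prod
  exact Finset.measurable_fun_prod (m := sigmaOn X T) _ fun i hi =>
    Measurable.pow_const (measurable_sigmaOn (hn hi)) _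

variable [mΩ : MeasurableSpace Ω] {μ : Measure Ω}

/-- If `W` is orthogonal to all powers of a bounded variable `Y`, it integrates to `0` over all
events in `σ(Y)`. -/
lemma setIntegral_preimage_eq_zero [IsFiniteMeasure μ] {Y W : Ω → ℝ} {R : ℝ} (hY : Measurable Y)
    (hR : ∀ᵐ ω ∂μ, |Y ω| ≤ R) (hW : Integrable W μ) (h : ∀ n : ℕ, ∫ ω, W ω * Y ω ^ n ∂μ = 0)
    {B : Set ℝ} (hB : MeasurableSet B) : ∫ ω in Y ⁻¹' B, W ω ∂μ = 0 := by
  have hfin := isFiniteMeasure_withDensity_ofReal hW.2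
  have hfin' := isFiniteMeasure_withDensity_ofReal hW.neg.2
  set ν₁ := (μ.withDensity fun ω => ENNReal.ofReal (W ω)).map Y with hν₁
  set ν₂ := (μ.withDensity fun ω => ENNReal.ofReal ((-W) ω)).map Y with hν₂
  have hac : ∀ V : Ω → ℝ, ∀ᵐ y ∂((μ.withDensity fun ω => ENNReal.ofReal (V ω)).map Y), |y| ≤ R := by
    intro V
    refine (ae_map_iff hY.aemeasurable (p := fun y => |y| ≤ R)
      (measurableSet_le (by fun_prop) measurable_const)).2 ?_
    exact (withDensity_absolutelyContinuous μ _).ae_le hR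
  have hmom : ∀ V : Ω → ℝ, Integrable V μ → ∀ n : ℕ,
      ∫ y, y ^ n ∂((μ.withDensity fun ω => ENNReal.ofReal (V ω)).map Y) =
        ∫ ω, max (V ω) 0 * Y ω ^ n ∂μ := by
    intro V hV n
    rw [integral_map hY.aemeasurable (by fun_prop),
      integral_withDensity_eq_integral_toReal_smul₀ hV.1.aemeasurable.ennreal_ofReal
        (Eventually.of_forall fun _ => ENNReal.ofReal_lt_top)]
    simp only [ENNReal.toReal_ofReal', smul_eq_mul]
  have hmul : ∀ V : Ω → ℝ, Integrable V μ → ∀ n : ℕ, Integrable (fun ω => V ω * Y ω ^ n) μ := by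
    intro V hV n
    refine hV.mul_bdd (c := R ^ n) (by fun_prop) ?_
    filter_upwards [hR] with ω hω
    rw [norm_pow, Real.norm_eq_abs]
    exact pow_le_pow_left₀ (abs_nonneg _) hω n
  have heq : ν₁ = ν₂ := by
    refine measure_eq_of_moments (hac W) (integrable_pow_of_ae_abs_le (hac (-W))) fun n => ?_
    rw [hmom W hW, hmom (-W) hW.neg, ← sub_eq_zero,
      ← integral_sub (hmul _ hW.pos_part n) (hmul _ hW.neg.pos_part n)]
    refine (integral_congr_ae (Eventually.of_forall fun ω => ?_)).trans (h n)
    simp only [Pi.neg_apply]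
    rw [← sub_mul, max_zero_sub_max_neg_zero_eq_self]
  have hB' := congrArg (fun ν => ν B) heq
  simp only [hν₁, hν₂, Measure.map_apply hY hB, withDensity_apply _ (hY hB), Pi.neg_apply] at hB'
  rw [integral_eq_lintegral_pos_part_sub_lintegral_neg_part hW.integrableOn, hB', sub_self]

lemma sigmaOn_le {X : ℝ≥0 → Ω → ℝ} (hX : ∀ i, Measurable (X i)) (T : Set ℝ≥0) :
    sigmaOn X T ≤ mΩ :=
  iSup₂_le fun i _ => (hX i).comap_le

lemma coordMonomial_bounded {X : ℝ≥0 → Ω → ℝ} (hb : ∀ i, ∃ R, ∀ᵐ ω ∂μ, |X i ω| ≤ R)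
    (n : ℝ≥0 →₀ ℕ) : ∃ C, ∀ᵐ ω ∂μ, |coordMonomial X n ω| ≤ C := by
  induction n using Finsupp.induction with
  | zero => exact ⟨1, by simp [coordMonomial_zero]⟩
  | single_add i k n _ _ ih =>
    obtain ⟨C, hC⟩ := ih
    obtain ⟨R, hR⟩ := hb i
    refine ⟨R ^ k * C, ?_⟩
    filter_upwards [hC, hR] with ω h1 h2
    rw [coordMonomial_add, coordMonomial_single, abs_mul, abs_pow]
    have h3 := pow_le_pow_left₀ (abs_nonneg _) h2 k
    exact mul_le_mul h3 h1 (abs_nonneg _) ((pow_nonneg (abs_nonneg _) k).trans h3)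

/-- If `Z` is orthogonal to all monomials in bounded variables `X_i`, `i ∈ T`, it integrates to `0`
over all events in `σ {X_i : i ∈ T}`. -/
lemma setIntegral_sigmaOn_eq_zero [IsFiniteMeasure μ] {X : ℝ≥0 → Ω → ℝ} {T : Set ℝ≥0}
    (hX : ∀ i, Measurable (X i)) (hb : ∀ i, ∃ R, ∀ᵐ ω ∂μ, |X i ω| ≤ R) {Z : Ω → ℝ}
    (hZ : Integrable Z μ)
    (h : ∀ n : ℝ≥0 →₀ ℕ, (n.support : Set ℝ≥0) ⊆ T → ∫ ω, Z ω * coordMonomial X n ω ∂μ = 0)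
    {S : Set Ω} (hS : MeasurableSet[sigmaOn X T] S) : ∫ ω in S, Z ω ∂μ = 0 := by
  classical
  have hinter : ∀ F : Finset ℝ≥0, (F : Set ℝ≥0) ⊆ T → ∀ f : ℝ≥0 → Set Ω,
      (∀ i ∈ F, MeasurableSet[MeasurableSpace.comap (X i) inferInstance] (f i)) →
      ∀ Z : Ω → ℝ, Integrable Z μ →
      (∀ n : ℝ≥0 →₀ ℕ, (n.support : Set ℝ≥0) ⊆ T → ∫ ω, Z ω * coordMonomial X n ω ∂μ = 0) →
      ∫ ω in ⋂ i ∈ F, f i, Z ω ∂μ = 0 := by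
    intro F
    induction F using Finset.induction_on with
    | empty =>
      intro _ f _ Z _ h
      simpa [coordMonomial_zero] using h 0 (by simp)
    | insert a F _ ih =>
      intro hF f hf Z hZ h
      obtain ⟨B, hB, hBf⟩ := hf a (Finset.mem_insert_self a F)
      have hfa : MeasurableSet (f a) := hBf ▸ hX a hB
      have haT : a ∈ T := hF (by simp)
      rw [Finset.set_biInter_insert, Set.inter_comm, ← setIntegral_indicator hfa]
      refine ih (fun i hi => hF (by simp [Finset.mem_coe.1 hi])) f
        (fun i hi => hf i (Finset.mem_insert_of_mem hi)) _ (hZ.indicator hfa) fun n hn => ?_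
      obtain ⟨C, hC⟩ := coordMonomial_bounded hb n
      obtain ⟨R, hR⟩ := hb a
      have hint : Integrable (fun ω => Z ω * coordMonomial X n ω) μ :=
        hZ.mul_bdd (c := C) ((measurable_coordMonomial hn).mono (sigmaOn_le hX T)
          le_rfl).aestronglyMeasurable hC
      calc ∫ ω, (f a).indicator (fun ω => Z ω) ω * coordMonomial X n ω ∂μ
          = ∫ ω, (f a).indicator (fun ω => Z ω * coordMonomial X n ω) ω ∂μ := by
            refine integral_congr_ae (Eventually.of_forall fun ω => ?_)
            simp only [Set.indicator_apply]
            split_ifs <;> simp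
        _ = ∫ ω in X a ⁻¹' B, Z ω * coordMonomial X n ω ∂μ := by
            rw [integral_indicator hfa, hBf]
        _ = 0 := by
            refine setIntegral_preimage_eq_zero (hX a) hR hint (fun k => ?_) hB
            rw [← h (n + Finsupp.single a k) ?_]
            · refine integral_congr_ae (Eventually.of_forall fun ω => ?_)
              simp only [coordMonomial_add, coordMonomial_single, mul_assoc]
            · refine (Finset.coe_subset.2 Finsupp.support_add).trans ?_
              rw [Finset.coe_union]
              refine Set.union_subset hn ?_
              refine (Finset.coe_subset.2 Finsupp.support_single_subset).trans ?_
              simpa using haT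
  have hle := sigmaOn_le hX T
  have hgen := (generateFrom_piiUnionInter_measurableSet
    (fun i => MeasurableSpace.comap (X i) inferInstance) T).symm
  have hpi := isPiSystem_piiUnionInter
    (fun i => {s | MeasurableSet[MeasurableSpace.comap (X i) inferInstance] s})
    (fun i => @MeasurableSpace.isPiSystem_measurableSet _
      (MeasurableSpace.comap (X i) inferInstance)) T
  have huniv : ∫ ω, Z ω ∂μ = 0 := by simpa [coordMonomial_zero] using h 0 (by simp)
  induction S, hS using MeasurableSpace.induction_on_inter hgen hpi with
  | empty => simp
  | basic S hS =>
    obtain ⟨F, hF, f, hf, rfl⟩ := hS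
    exact hinter F hF f hf Z hZ h
  | compl S hS ih =>
    have := integral_add_compl (hle _ hS) hZ
    rw [ih, huniv] at this
    linarith
  | iUnion f hd hf ih =>
    rw [integral_iUnion (fun i => hle _ (hf i)) hd hZ.integrableOn]
    simp [ih]

end Monomials

/-! ### Martingale polynomials along the kernels -/

section Propagation

open ProbabilityTheory Filter

variable {η θ s t : ℝ}

/-- A kernel that extends `P_{s,t}` maps a boundedly supported measure on the domain to a boundedly
supported one, and moves the integrals of the martingale polynomials from time `t` to time `s`. -/
lemma integral_bpM_comp (hηθ : 0 ≤ 1 + η * θ) (hs : 0 ≤ s) (hst : s < t) {κ : Kernel ℝ ℝ}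
    [IsMarkovKernel κ] (hκ : ∀ x, 0 ≤ 1 + x * η → κ x = bpTransition η θ s t x)
    {ρ : Measure ℝ} [IsFiniteMeasure ρ] {k : ℝ} (hk : ∀ᵐ x ∂ρ, |x| ≤ k)
    (hdom : ∀ᵐ x ∂ρ, 0 ≤ 1 + x * η) :
    (∃ R, ∀ᵐ y ∂(κ ∘ₘ ρ), |y| ≤ R) ∧
      ∀ n, ∫ y, (bpM η θ t n).eval y ∂(κ ∘ₘ ρ) = ∫ x, (bpM η θ s n).eval x ∂ρ := by
  obtain ⟨R, -, hR⟩ := exists_uniform_support_bound (η := η) hηθ hs hst k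
  have hbd : ∀ᵐ y ∂(κ ∘ₘ ρ), |y| ≤ R := by
    refine Measure.ae_comp_of_ae_ae (measurableSet_le (by fun_prop) measurable_const) ?_
    filter_upwards [hk, hdom] with x hx hx'
    rw [hκ x hx']
    exact hR x hx hx'
  refine ⟨⟨R, hbd⟩, fun n => ?_⟩
  have hint : Integrable (fun y => (bpM η θ t n).eval y) (κ ∘ₘ ρ) :=
    Integrable.polynomial_eval (integrable_pow_of_ae_abs_le hbd) _
  have hint' := (Measure.integrable_compProd_snd_iff hint.1).2 hint
  have hcont : Continuous fun y => (bpM η θ t n).eval y := (bpM η θ t n).continuous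
  rw [← Measure.snd_compProd, Measure.snd, integral_map measurable_snd.aemeasurable
    hcont.aestronglyMeasurable, Measure.integral_compProd hint']
  refine integral_congr_ae ?_
  filter_upwards [hdom] with x hx
  rw [hκ x hx]
  exact integral_bpTransition_bpM hηθ hs hst hx n

end Propagation

/-! ### Bounded random variables -/

section Bounded

open Filter

variable {Ω : Type*} [MeasurableSpace Ω] {μ : Measure Ω}

/-- Essentially bounded real random variables. -/
def IsBdd (μ : Measure Ω) (f : Ω → ℝ) : Prop :=
  AEStronglyMeasurable f μ ∧ ∃ C, ∀ᵐ ω ∂μ, |f ω| ≤ C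

lemma IsBdd.integrable [IsFiniteMeasure μ] {f : Ω → ℝ} (hf : IsBdd μ f) : Integrable f μ := by
  obtain ⟨hm, C, hC⟩ := hf
  exact Integrable.of_bound hm C hC

lemma isBdd_const (c : ℝ) : IsBdd μ fun _ => c :=
  ⟨aestronglyMeasurable_const, |c|, by simp⟩

lemma IsBdd.mul {f g : Ω → ℝ} (hf : IsBdd μ f) (hg : IsBdd μ g) : IsBdd μ fun ω => f ω * g ω := by
  obtain ⟨hm, C, hC⟩ := hf
  obtain ⟨hm', C', hC'⟩ := hg
  refine ⟨hm.mul hm', C * C', ?_⟩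
  filter_upwards [hC, hC'] with ω h h'
  rw [abs_mul]
  exact mul_le_mul h h' (abs_nonneg _) ((abs_nonneg _).trans h)

lemma IsBdd.add {f g : Ω → ℝ} (hf : IsBdd μ f) (hg : IsBdd μ g) : IsBdd μ fun ω => f ω + g ω := by
  obtain ⟨hm, C, hC⟩ := hf
  obtain ⟨hm', C', hC'⟩ := hg
  refine ⟨hm.add hm', C + C', ?_⟩
  filter_upwards [hC, hC'] with ω h h'
  exact (abs_add_le _ _).trans (add_le_add h h')

lemma IsBdd.const_mul {f : Ω → ℝ} (hf : IsBdd μ f) (c : ℝ) : IsBdd μ fun ω => c * f ω :=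
  (isBdd_const c).mul hf

lemma IsBdd.pow {f : Ω → ℝ} (hf : IsBdd μ f) (n : ℕ) : IsBdd μ fun ω => f ω ^ n := by
  induction n with
  | zero => simpa using isBdd_const 1
  | succ n ih => simpa only [pow_succ] using ih.mul hf

lemma IsBdd.sum {ι : Type*} (F : Finset ι) {f : ι → Ω → ℝ} (hf : ∀ i, IsBdd μ (f i)) :
    IsBdd μ fun ω => ∑ i ∈ F, f i ω := by
  classical
  induction F using Finset.induction_on with
  | empty => simpa using isBdd_const 0
  | insert a F ha ih => simpa only [Finset.sum_insert ha] using (hf a).add ih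

lemma IsBdd.polynomial_eval {f : Ω → ℝ} (hf : IsBdd μ f) (p : ℝ[X]) :
    IsBdd μ fun ω => p.eval (f ω) := by
  simp only [eval_eq_sum_range]
  exact IsBdd.sum _ fun i => (hf.pow i).const_mul _

end Bounded

/-! ### Martingale characterization of the process -/

section MartingaleForm

open ProbabilityTheory Filter

variable {Ω : Type*} [mΩ : MeasurableSpace Ω] {μ : Measure Ω}

/-- `X` is a bounded process on the domain `1 + x η ≥ 0` that starts at `0` and for which all
`M_n(X_t; t)` are martingales. If `1 + η θ ≥ 0`, this is equivalent to
`IsFreeBiPoisson`, but it does not mention the transition probabilities. -/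
structure IsPolyMartingale (η θ : ℝ) (μ : Measure Ω) (X : ℝ≥0 → Ω → ℝ) : Prop where
  measurable : ∀ t, Measurable (X t)
  bounded : ∀ t, ∃ R, ∀ᵐ ω ∂μ, |X t ω| ≤ R
  domain : ∀ t, ∀ᵐ ω ∂μ, 0 ≤ 1 + X t ω * η
  start : ∀ᵐ ω ∂μ, X 0 ω = 0
  martingale : ∀ s t : ℝ≥0, s < t → ∀ (n : ℕ) (S : Set Ω), MeasurableSet[pastField X s] S →
    ∫ ω in S, (bpM η θ t n).eval (X t ω) ∂μ = ∫ ω in S, (bpM η θ s n).eval (X s ω) ∂μ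

variable {η θ : ℝ} {X : ℝ≥0 → Ω → ℝ}

/-- The Markov property in terms of laws: on every event in the past of `s`, the law of `X_t` is
that of `X_s` moved by the kernel. -/
lemma IsFreeBiPoisson.law_restrict [IsProbabilityMeasure μ] (h : IsFreeBiPoisson η θ μ X)
    {s t : ℝ≥0} (hst : s < t) (hdom : ∀ᵐ ω ∂μ, 0 ≤ 1 + X s ω * η) {κ : Kernel ℝ ℝ}
    [IsMarkovKernel κ] (hκ : ∀ x, 0 ≤ 1 + x * η → κ x = bpTransition η θ s t x) {S : Set Ω}
    (hS : MeasurableSet[pastField X s] S) :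
    (μ.restrict S).map (X t) = κ ∘ₘ (μ.restrict S).map (X s) := by
  have hle : pastField X s ≤ mΩ := sigmaOn_le h.measurable _
  ext A hA
  rw [Measure.bind_apply hA κ.aemeasurable, lintegral_map (κ.measurable_coe hA) (h.measurable s),
    Measure.map_apply (h.measurable t) hA, ← ENNReal.toReal_eq_toReal_iff' (measure_ne_top _ _)
      (by
        refine ((lintegral_mono fun ω => prob_le_one).trans_lt ?_).ne
        simp), ← integral_toReal (f := fun ω => κ (X s ω) A)
      ((κ.measurable_coe hA).comp (h.measurable s)).aemeasurable
      (Eventually.of_forall fun ω => measure_lt_top _ _)]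
  have h1 : ∫ ω in S, (κ (X s ω) A).toReal ∂μ =
      ∫ ω in S, (μ[(X t ⁻¹' A).indicator (fun _ => (1 : ℝ)) | pastField X s]) ω ∂μ := by
    refine setIntegral_congr_ae (hle _ hS) ?_
    filter_upwards [h.markov s t hst A hA, hdom] with ω hω hd _
    rw [hω, hκ _ hd]
    rfl
  rw [h1, setIntegral_condExp hle
    ((integrable_const (1 : ℝ)).indicator (h.measurable t hA)) hS,
    integral_indicator (h.measurable t hA)]
  simp [measureReal_def]

/-- Since `X_0 = 0`, the law of `X_t` for `t > 0` is `P_{0,t}(0, ·)`, which lives on a bounded part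
of the domain. -/
lemma IsFreeBiPoisson.domain_bounded [IsProbabilityMeasure μ] (hηθ : 0 ≤ 1 + η * θ)
    (h : IsFreeBiPoisson η θ μ X) (t : ℝ≥0) :
    (∀ᵐ ω ∂μ, 0 ≤ 1 + X t ω * η) ∧ ∃ R, ∀ᵐ ω ∂μ, |X t ω| ≤ R := by
  have hdom0 : ∀ᵐ ω ∂μ, 0 ≤ 1 + X 0 ω * η := by
    filter_upwards [h.start] with ω hω
    simp [hω]
  rcases eq_or_lt_of_le (zero_le (a := t)) with rfl | ht
  · refine ⟨hdom0, 0, ?_⟩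
    filter_upwards [h.start] with ω hω
    simp [hω]
  · have ht' : (0 : ℝ) < t := ht
    obtain ⟨κ, hκm, hκ⟩ := exists_transitionKernel (η := η) (θ := θ) hηθ le_rfl ht'
    have hlaw := h.law_restrict ht hdom0 (κ := κ) (by simpa using hκ) MeasurableSet.univ
    have h0 : (μ.restrict Set.univ).map (X 0) = Measure.dirac 0 := by
      rw [Measure.restrict_univ, Measure.map_congr (g := fun _ => (0 : ℝ)) h.start]
      simp
    have hd : (0 : ℝ) ≤ 1 + 0 * η := by simp
    rw [h0, Measure.dirac_bind κ.measurable, hκ 0 hd, Measure.restrict_univ] at hlaw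
    have hsupp := bpTransition_support hηθ le_rfl ht' hd
    rw [← hlaw] at hsupp
    exact ⟨ae_of_ae_map (h.measurable t).aemeasurable hsupp.1, _,
      ae_of_ae_map (h.measurable t).aemeasurable hsupp.2⟩

lemma IsFreeBiPoisson.isPolyMartingale [IsProbabilityMeasure μ] (hηθ : 0 ≤ 1 + η * θ)
    (h : IsFreeBiPoisson η θ μ X) : IsPolyMartingale η θ μ X where
  measurable := h.measurable
  bounded t := (h.domain_bounded hηθ t).2
  domain t := (h.domain_bounded hηθ t).1
  start := h.start
  martingale s t hst n S hS := by
    obtain ⟨κ, hκm, hκ⟩ := exists_transitionKernel (η := η) (θ := θ) hηθ s.2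
      (NNReal.coe_lt_coe.2 hst)
    obtain ⟨hdom, R, hR⟩ := h.domain_bounded hηθ s
    have hmap : ∀ {p : ℝ → Prop}, MeasurableSet {x | p x} → (∀ᵐ ω ∂μ, p (X s ω)) →
        ∀ᵐ x ∂(μ.restrict S).map (X s), p x := fun hp h' =>
      (ae_map_iff (h.measurable s).aemeasurable hp).2 (ae_restrict_of_ae h')
    have key := (integral_bpM_comp hηθ s.2 (NNReal.coe_lt_coe.2 hst) hκ
      (hmap (p := fun x => |x| ≤ R) (measurableSet_le (by fun_prop) measurable_const) hR)
      (hmap (p := fun x => 0 ≤ 1 + x * η) (measurableSet_le measurable_const (by fun_prop))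
        hdom)).2 n
    rwa [← h.law_restrict hst hdom hκ hS,
      integral_map (h.measurable t).aemeasurable (Polynomial.continuous _).aestronglyMeasurable,
      integral_map (h.measurable s).aemeasurable (Polynomial.continuous _).aestronglyMeasurable]
      at key

/-- Boundedness, the domain condition and the martingale property determine the transition
probabilities, since these are determined by their moments. -/
lemma IsPolyMartingale.isFreeBiPoisson [IsProbabilityMeasure μ] (hηθ : 0 ≤ 1 + η * θ)
    (h : IsPolyMartingale η θ μ X) : IsFreeBiPoisson η θ μ X where
  measurable := h.measurable
  start := h.start
  markov s t hst A hA := by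
    have hle : pastField X s ≤ mΩ := sigmaOn_le h.measurable _
    obtain ⟨κ, hκm, hκ⟩ := exists_transitionKernel (η := η) (θ := θ) hηθ s.2
      (NNReal.coe_lt_coe.2 hst)
    obtain ⟨R, hR⟩ := h.bounded s
    obtain ⟨R', hR'⟩ := h.bounded t
    have hlaw : ∀ S : Set Ω, MeasurableSet[pastField X s] S →
        (μ.restrict S).map (X t) = κ ∘ₘ (μ.restrict S).map (X s) := by
      intro S hS
      have hmap : ∀ {p : ℝ → Prop} (r : ℝ≥0), MeasurableSet {x | p x} → (∀ᵐ ω ∂μ, p (X r ω)) →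
          ∀ᵐ x ∂(μ.restrict S).map (X r), p x := fun r hp h' =>
        (ae_map_iff (h.measurable r).aemeasurable hp).2 (ae_restrict_of_ae h')
      obtain ⟨⟨R'', hR''⟩, key⟩ := integral_bpM_comp hηθ s.2 (NNReal.coe_lt_coe.2 hst) hκ
        (hmap (p := fun x => |x| ≤ R) s (measurableSet_le (by fun_prop) measurable_const) hR)
        (hmap (p := fun x => 0 ≤ 1 + x * η) s (measurableSet_le measurable_const (by fun_prop))
          (h.domain s))
      refine measure_eq_of_integral_bpQ η θ 0 t 0
        (hmap (p := fun x => |x| ≤ R') t (measurableSet_le (by fun_prop) measurable_const) hR')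
        (integrable_pow_of_ae_abs_le hR'') fun n => ?_
      rw [key n,
        integral_map (h.measurable t).aemeasurable (Polynomial.continuous _).aestronglyMeasurable,
        integral_map (h.measurable s).aemeasurable (Polynomial.continuous _).aestronglyMeasurable]
      exact h.martingale s t hst n S hS
    have hreal : ∀ᵐ ω ∂μ, (κ (X s ω)).real A = (bpTransition η θ s t (X s ω)).real A := by
      filter_upwards [h.domain s] with ω hω
      exact congrArg (fun ν : Measure ℝ => ν.real A) (hκ _ hω)
    have hmeas : Measurable[pastField X s] fun ω => (κ (X s ω)).real A :=
      (κ.measurable_coe hA).ennreal_toReal.comp (measurable_sigmaOn (Set.mem_Iic.2 le_rfl))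
    have hbdd : Integrable (fun ω => (κ (X s ω)).real A) μ := by
      refine Integrable.of_bound (hmeas.mono hle le_rfl).aestronglyMeasurable 1
        (Eventually.of_forall fun ω => ?_)
      rw [Real.norm_eq_abs, abs_of_nonneg measureReal_nonneg]
      exact measureReal_le_one
    refine EventuallyEq.trans (EventuallyEq.symm ?_) hreal
    refine ae_eq_condExp_of_forall_setIntegral_eq hle
      ((integrable_const (1 : ℝ)).indicator (h.measurable t hA)) (fun _ _ _ => hbdd.integrableOn)
      (fun S hS _ => ?_) hmeas.aestronglyMeasurable
    have hA' := congrArg (fun ν => (ν A).toReal) (hlaw S hS)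
    simp only [Measure.bind_apply hA κ.aemeasurable,
      lintegral_map (κ.measurable_coe hA) (h.measurable s),
      Measure.map_apply (h.measurable t) hA] at hA'
    rw [← integral_toReal (f := fun ω => κ (X s ω) A)
      ((κ.measurable_coe hA).comp (h.measurable s)).aemeasurable
      (Eventually.of_forall fun ω => measure_lt_top _ _)] at hA'
    rw [integral_indicator (h.measurable t hA)]
    simp only [integral_const, smul_eq_mul, mul_one, measureReal_def, Measure.restrict_apply_univ]
    exact hA'.symm

end MartingaleForm

/-! ### The three-term recurrence as a Jacobi matrix affine in time -/

/-- The tridiagonal matrix of the three-term recurrence of the `M_n(·; t)`, acting on sequences.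
It is affine in `t`. -/
def bpJacobi (η θ t : ℝ) (m : ℕ → ℝ) : ℕ → ℝ
  | 0 => m 1
  | 1 => m 2 + (t * η + θ) * m 1 + t * m 0
  | n + 2 => m (n + 3) + (t * η + θ) * m (n + 2) + t * (1 + η * θ) * m (n + 1)

lemma mul_eval_bpM (η θ t y : ℝ) (n : ℕ) :
    y * (bpM η θ t n).eval y = bpJacobi η θ t (fun k => (bpM η θ t k).eval y) n := by
  match n with
  | 0 => simp [bpJacobi, bpQ_zero, bpQ_one]
  | 1 => simp [bpJacobi, bpQ_zero, bpQ_one, bpQ_two]; ring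
  | n + 2 => simp [bpJacobi, bpQ_add_three]; ring

lemma bpJacobi_affine (η θ : ℝ) {s t u : ℝ} (hsu : u - s ≠ 0) (m : ℕ → ℝ) (n : ℕ) :
    bpJacobi η θ t m n = (u - t) / (u - s) * bpJacobi η θ s m n
      + (t - s) / (u - s) * bpJacobi η θ u m n := by
  match n with
  | 0 => simp only [bpJacobi]; field_simp; ring
  | 1 => simp only [bpJacobi]; field_simp; ring
  | n + 2 => simp only [bpJacobi]; field_simp; ring

/-- The quadratic identity behind the conditional variance. Writing the Jacobi matrix as `A + t B`,
it amounts to the relation `A B = 1 + η A + θ B`. -/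
lemma bpJacobi_quadratic (η θ : ℝ) {s t u : ℝ} (hu : u ≠ 0) (hsu : u - s ≠ 0) (m : ℕ → ℝ) (n : ℕ) :
    bpJacobi η θ t (bpJacobi η θ t m) n =
      (((u - t) / (u - s)) ^ 2 + (u - t) * (t - s) / u * (u / (u - s) ^ 2)) *
          bpJacobi η θ s (bpJacobi η θ s m) n
        + (2 * ((u - t) / (u - s)) * ((t - s) / (u - s))
            + (u - t) * (t - s) / u * (-(u + s) / (u - s) ^ 2)) *
          bpJacobi η θ u (bpJacobi η θ s m) n
        + (((t - s) / (u - s)) ^ 2 + (u - t) * (t - s) / u * (s / (u - s) ^ 2)) *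
          bpJacobi η θ u (bpJacobi η θ u m) n
        + (u - t) * (t - s) / u * ((η * u - θ) / (u - s)) * bpJacobi η θ s m n
        + (u - t) * (t - s) / u * ((θ - η * s) / (u - s)) * bpJacobi η θ u m n
        + (u - t) * (t - s) / u * m n := by
  match n with
  | 0 => simp only [bpJacobi]; field_simp; ring
  | 1 => simp only [bpJacobi]; field_simp; ring
  | 2 => simp only [bpJacobi]; field_simp; ring
  | n + 3 => simp only [bpJacobi]; field_simp; ring

/-! ### Conditional moments given the past and the future -/

section Harness

open ProbabilityTheory Filter

variable {Ω : Type*} [mΩ : MeasurableSpace Ω] {μ : Measure Ω}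
  {η θ : ℝ} {X : ℝ≥0 → Ω → ℝ}

lemma IsPolyMartingale.isBdd (h : IsPolyMartingale η θ μ X) (t : ℝ≥0) : IsBdd μ (X t) :=
  ⟨(h.measurable t).aestronglyMeasurable, h.bounded t⟩

lemma IsPolyMartingale.integral_mul_bpM [IsProbabilityMeasure μ]
    (h : IsPolyMartingale η θ μ X) {s t : ℝ≥0} (hst : s ≤ t)
    {φ : Ω → ℝ} (hφ : Measurable[pastField X s] φ) (hb : IsBdd μ φ) (n : ℕ) :
    ∫ ω, φ ω * (bpM η θ t n).eval (X t ω) ∂μ = ∫ ω, φ ω * (bpM η θ s n).eval (X s ω) ∂μ := by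
  rcases eq_or_lt_of_le hst with rfl | hst
  · rfl
  have hle : pastField X s ≤ mΩ := sigmaOn_le h.measurable _
  have it := (h.isBdd t).polynomial_eval (bpM η θ t n)
  have is := (h.isBdd s).polynomial_eval (bpM η θ s n)
  have hcond : (fun ω => (bpM η θ s n).eval (X s ω)) =ᵐ[μ]
      μ[fun ω => (bpM η θ t n).eval (X t ω) | pastField X s] := by
    refine ae_eq_condExp_of_forall_setIntegral_eq hle it.integrable
      (fun _ _ _ => is.integrable.integrableOn)
      (fun S hS _ => (h.martingale s t hst n S hS).symm) ?_
    exact ((Polynomial.continuous _).measurable.comp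
      (measurable_sigmaOn (Set.mem_Iic.2 le_rfl))).aestronglyMeasurable
  have hpull := condExp_mul_of_stronglyMeasurable_left (μ := μ) hφ.stronglyMeasurable
    (hb.mul it).integrable it.integrable
  calc ∫ ω, φ ω * (bpM η θ t n).eval (X t ω) ∂μ
      = ∫ ω, (μ[φ * (fun ω => (bpM η θ t n).eval (X t ω)) | pastField X s]) ω ∂μ :=
        (integral_condExp hle).symm
    _ = _ := by
      refine integral_congr_ae ?_
      filter_upwards [hpull, hcond] with ω h1 h2
      rw [h1, Pi.mul_apply, ← h2]

/-- Polynomials in `X_t` condition on the past to polynomials in `X_s`. -/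
lemma IsPolyMartingale.exists_polynomial [IsProbabilityMeasure μ]
    (h : IsPolyMartingale η θ μ X) {s t : ℝ≥0} (hst : s ≤ t)
    (p : ℝ[X]) : ∃ q : ℝ[X], ∀ φ : Ω → ℝ, Measurable[pastField X s] φ → IsBdd μ φ →
      ∫ ω, φ ω * p.eval (X t ω) ∂μ = ∫ ω, φ ω * q.eval (X s ω) ∂μ := by
  refine bpQ_induction η θ 0 t 0 (P := fun p => ∃ q : ℝ[X], ∀ φ : Ω → ℝ,
    Measurable[pastField X s] φ → IsBdd μ φ →
      ∫ ω, φ ω * p.eval (X t ω) ∂μ = ∫ ω, φ ω * q.eval (X s ω) ∂μ) ⟨0, by simp⟩ ?_ ?_ ?_ p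
  · intro p p' hp hp'
    obtain ⟨q, hq⟩ := hp
    obtain ⟨q', hq'⟩ := hp'
    refine ⟨q + q', fun φ hφ hb => ?_⟩
    simp only [eval_add, mul_add]
    rw [integral_add (hb.mul ((h.isBdd t).polynomial_eval _)).integrable
      (hb.mul ((h.isBdd t).polynomial_eval _)).integrable,
      integral_add (hb.mul ((h.isBdd s).polynomial_eval _)).integrable
      (hb.mul ((h.isBdd s).polynomial_eval _)).integrable, hq φ hφ hb, hq' φ hφ hb]
  · intro a p hp
    obtain ⟨q, hq⟩ := hp
    refine ⟨a • q, fun φ hφ hb => ?_⟩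
    simp only [eval_smul, smul_eq_mul, mul_left_comm _ a, integral_const_mul, hq φ hφ hb]
  · exact fun n => ⟨bpM η θ s n, fun φ hφ hb => h.integral_mul_bpM hst hφ hb n⟩

lemma IsPolyMartingale.isBdd_coordMonomial (h : IsPolyMartingale η θ μ X) (n : ℝ≥0 →₀ ℕ) :
    IsBdd μ (coordMonomial X n) :=
  ⟨((measurable_coordMonomial (Set.subset_univ _)).mono
    (sigmaOn_le h.measurable _) le_rfl).aestronglyMeasurable, coordMonomial_bounded h.bounded n⟩

/-- Monomials in the future of `u` condition on the past of `u` to polynomials in `X_u`. -/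
lemma IsPolyMartingale.exists_polynomial_future [IsProbabilityMeasure μ]
    (h : IsPolyMartingale η θ μ X) (F : Finset ℝ≥0)
    (n : ℝ≥0 → ℕ) : ∀ u : ℝ≥0, (∀ i ∈ F, u ≤ i) → ∃ q : ℝ[X], ∀ φ : Ω → ℝ,
      Measurable[pastField X u] φ → IsBdd μ φ →
      ∫ ω, φ ω * ∏ i ∈ F, X i ω ^ n i ∂μ = ∫ ω, φ ω * q.eval (X u ω) ∂μ := by
  classical
  induction F using Finset.induction_on_min with
  | empty => exact fun u _ => ⟨1, fun φ _ _ => by simp⟩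
  | insert a F ha ih =>
    intro u hu
    obtain ⟨q, hq⟩ := ih a fun i hi => (ha i hi).le
    have hua : u ≤ a := hu a (Finset.mem_insert_self a F)
    obtain ⟨q', hq'⟩ := h.exists_polynomial hua (Polynomial.X ^ n a * q)
    refine ⟨q', fun φ hφ hb => ?_⟩
    have haF : a ∉ F := fun h' => lt_irrefl a (ha a h')
    simp only [Finset.prod_insert haF, ← mul_assoc]
    rw [hq (fun ω => φ ω * X a ω ^ n a) ?_ (hb.mul ((h.isBdd a).pow _)), ← hq' φ hφ hb]
    · simp only [eval_mul, eval_pow, eval_X, mul_assoc]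
    · exact (hφ.mono (sigmaOn_mono X (Set.Iic_subset_Iic.2 hua)) le_rfl).mul
        ((measurable_sigmaOn (Set.mem_Iic.2 le_rfl)).pow_const _)

/-- To show that `Z` has zero conditional expectation given the past of `s` and the future of `u`
it suffices to test against the past times the `M_n(X_u; u)`. -/
lemma IsPolyMartingale.setIntegral_outerField_eq_zero [IsProbabilityMeasure μ]
    (h : IsPolyMartingale η θ μ X) {s u : ℝ≥0}
    (hsu : s ≤ u) {Z : Ω → ℝ} (hZ : Measurable[pastField X u] Z) (hZb : IsBdd μ Z)
    (hzero : ∀ φ : Ω → ℝ, Measurable[pastField X s] φ → IsBdd μ φ → ∀ n,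
      ∫ ω, φ ω * Z ω * (bpM η θ u n).eval (X u ω) ∂μ = 0)
    {S : Set Ω} (hS : MeasurableSet[outerField X s u] S) : ∫ ω in S, Z ω ∂μ = 0 := by
  classical
  refine setIntegral_sigmaOn_eq_zero h.measurable h.bounded hZb.integrable (fun n hn => ?_) hS
  have hpast : Measurable[pastField X s] (coordMonomial X (n.filter (· ≤ s))) := by
    refine measurable_coordMonomial fun i hi => ?_
    rw [Finsupp.support_filter, Finset.mem_coe, Finset.mem_filter] at hi
    exact hi.2
  have hpastb : IsBdd μ (coordMonomial X (n.filter (· ≤ s))) := h.isBdd_coordMonomial _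
  obtain ⟨q, hq⟩ := h.exists_polynomial_future (n.filter (¬ · ≤ s)).support
    (n.filter (¬ · ≤ s)) u (by
      intro i hi
      rw [Finsupp.support_filter, Finset.mem_filter] at hi
      rcases hn (Finset.mem_coe.2 hi.1) with h' | h'
      · exact absurd h' hi.2
      · exact h')
  have hmeas : Measurable[pastField X u] fun ω =>
      coordMonomial X (n.filter (· ≤ s)) ω * Z ω :=
    (hpast.mono (sigmaOn_mono X (Set.Iic_subset_Iic.2 hsu)) le_rfl).mul hZ
  have hpoly : ∀ q : ℝ[X],
      ∫ ω, coordMonomial X (n.filter (· ≤ s)) ω * Z ω * q.eval (X u ω) ∂μ = 0 := by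
    refine bpQ_induction η θ 0 u 0 (by simp) ?_ ?_ (hzero _ hpast hpastb)
    · intro p q hp hq
      simp only [eval_add, mul_add]
      rw [integral_add ((hpastb.mul hZb).mul ((h.isBdd u).polynomial_eval _)).integrable
        ((hpastb.mul hZb).mul ((h.isBdd u).polynomial_eval _)).integrable, hp, hq, add_zero]
    · intro a p hp
      simp only [eval_smul, smul_eq_mul, mul_left_comm _ a, integral_const_mul, hp, mul_zero]
  have hsplit : ∀ ω, Z ω * coordMonomial X n ω =
      coordMonomial X (n.filter (· ≤ s)) ω * Z ω *
        ∏ i ∈ (n.filter (¬ · ≤ s)).support, X i ω ^ (n.filter (¬ · ≤ s)) i := by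
    intro ω
    conv_lhs => rw [← Finsupp.filter_add_filter_not n (· ≤ s), coordMonomial_add]
    rw [mul_left_comm, mul_assoc]
    rfl
  simp only [hsplit]
  rw [hq _ hmeas (hpastb.mul hZb)]
  exact hpoly q

lemma integral_mul_bpJacobi {φ : Ω → ℝ} {f : ℕ → Ω → ℝ}
    (hint : ∀ n, Integrable (fun ω => φ ω * f n ω) μ) (t : ℝ) (n : ℕ) :
    ∫ ω, φ ω * bpJacobi η θ t (fun k => f k ω) n ∂μ =
      bpJacobi η θ t (fun k => ∫ ω, φ ω * f k ω ∂μ) n := by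
  match n with
  | 0 => rfl
  | 1 =>
    simp only [bpJacobi, mul_add, mul_left_comm (φ _)]
    rw [integral_add ((hint _).fun_add ((hint _).const_mul _)) ((hint _).const_mul _),
      integral_add (hint _) ((hint _).const_mul _)]
    simp only [integral_const_mul]
  | n + 2 =>
    simp only [bpJacobi, mul_add, mul_left_comm (φ _)]
    rw [integral_add ((hint _).fun_add ((hint _).const_mul _)) ((hint _).const_mul _),
      integral_add (hint _) ((hint _).const_mul _)]
    simp only [integral_const_mul]

/-- Inserting a coordinate `X_t` between the past of `s` and `M_n(X_u; u)` applies the Jacobi matrix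
at time `t`. -/
lemma IsPolyMartingale.integral_mul_coord [IsProbabilityMeasure μ]
    (h : IsPolyMartingale η θ μ X) {s t u : ℝ≥0}
    (hst : s ≤ t) (htu : t ≤ u) {φ : Ω → ℝ} (hφ : Measurable[pastField X s] φ) (hb : IsBdd μ φ)
    (n : ℕ) :
    ∫ ω, φ ω * X t ω * (bpM η θ u n).eval (X u ω) ∂μ =
      bpJacobi η θ t (fun k => ∫ ω, φ ω * (bpM η θ s k).eval (X s ω) ∂μ) n := by
  have hmeas : Measurable[pastField X t] fun ω => φ ω * X t ω :=
    (hφ.mono (sigmaOn_mono X (Set.Iic_subset_Iic.2 hst)) le_rfl).mul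
      (measurable_sigmaOn (Set.mem_Iic.2 le_rfl))
  rw [h.integral_mul_bpM htu hmeas (hb.mul (h.isBdd t))]
  simp only [mul_assoc, mul_eval_bpM]
  rw [integral_mul_bpJacobi fun n => (hb.mul ((h.isBdd t).polynomial_eval _)).integrable]
  simp only [h.integral_mul_bpM hst hφ hb]

lemma IsPolyMartingale.integral_mul_coord_mul_coord [IsProbabilityMeasure μ]
    (h : IsPolyMartingale η θ μ X)
    {s v w u : ℝ≥0} (hsv : s ≤ v) (hvw : v ≤ w) (hwu : w ≤ u) {φ : Ω → ℝ}
    (hφ : Measurable[pastField X s] φ) (hb : IsBdd μ φ) (n : ℕ) :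
    ∫ ω, φ ω * (X v ω * X w ω) * (bpM η θ u n).eval (X u ω) ∂μ =
      bpJacobi η θ w (bpJacobi η θ v
        (fun k => ∫ ω, φ ω * (bpM η θ s k).eval (X s ω) ∂μ)) n := by
  have hmeas : Measurable[pastField X w] fun ω => φ ω * X v ω :=
    (hφ.mono (sigmaOn_mono X (Set.Iic_subset_Iic.2 (hsv.trans hvw))) le_rfl).mul
      (measurable_sigmaOn (Set.mem_Iic.2 hvw))
  simp only [← mul_assoc]
  rw [h.integral_mul_coord le_rfl hwu hmeas (hb.mul (h.isBdd v))]
  simp only [h.integral_mul_coord hsv hvw hφ hb]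

lemma IsPolyMartingale.condExp_linear [IsProbabilityMeasure μ]
    (h : IsPolyMartingale η θ μ X) {s t u : ℝ≥0} (hst : s < t)
    (htu : t < u) : μ[X t | outerField X s u] =ᵐ[μ] fun ω =>
      ((u : ℝ) - t) / (u - s) * X s ω + ((t : ℝ) - s) / (u - s) * X u ω := by
  have hle : outerField X s u ≤ mΩ := sigmaOn_le h.measurable _
  set a := ((u : ℝ) - t) / (u - s) with ha
  set b := ((t : ℝ) - s) / (u - s) with hbdef
  have hsu : (u : ℝ) - s ≠ 0 := sub_ne_zero.2 (by exact_mod_cast (hst.trans htu).ne')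
  have hlin : IsBdd μ fun ω => a * X s ω + b * X u ω :=
    ((h.isBdd s).const_mul a).add ((h.isBdd u).const_mul b)
  have hXs : Measurable[pastField X u] (X s) := measurable_sigmaOn (hst.trans htu).le
  have hXt : Measurable[pastField X u] (X t) := measurable_sigmaOn htu.le
  have hXu : Measurable[pastField X u] (X u) := measurable_sigmaOn (Set.mem_Iic.2 le_rfl)
  refine (ae_eq_condExp_of_forall_setIntegral_eq hle (h.isBdd t).integrable
    (fun _ _ _ => hlin.integrable.integrableOn) (fun S hS _ => ?_) ?_).symm
  · have key := h.setIntegral_outerField_eq_zero (hst.trans htu).le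
      (Z := fun ω => X t ω + (-1) * (a * X s ω + b * X u ω))
      (hXt.add (((hXs.const_mul a).add (hXu.const_mul b)).const_mul _))
      ((h.isBdd t).add (hlin.const_mul _)) ?_ hS
    · rw [integral_add (h.isBdd t).integrable.integrableOn
        (hlin.const_mul _).integrable.integrableOn, integral_const_mul] at key
      linarith
    · intro φ hφ hb n
      have i : ∀ r, Integrable (fun ω => φ ω * X r ω * (bpM η θ u n).eval (X u ω)) μ := fun r =>
        ((hb.mul (h.isBdd r)).mul ((h.isBdd u).polynomial_eval _)).integrable
      calc ∫ ω, φ ω * (X t ω + (-1) * (a * X s ω + b * X u ω)) *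
              (bpM η θ u n).eval (X u ω) ∂μ
          = ∫ ω, (φ ω * X t ω * (bpM η θ u n).eval (X u ω)
              - (a * (φ ω * X s ω * (bpM η θ u n).eval (X u ω))
                + b * (φ ω * X u ω * (bpM η θ u n).eval (X u ω)))) ∂μ := by
            congr 1; ext ω; ring
        _ = 0 := by
            rw [integral_sub (i t) (((i s).const_mul a).fun_add ((i u).const_mul b)),
              integral_add ((i s).const_mul a) ((i u).const_mul b), integral_const_mul,
              integral_const_mul, h.integral_mul_coord hst.le htu.le hφ hb,
              h.integral_mul_coord le_rfl (hst.trans htu).le hφ hb,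
              h.integral_mul_coord (hst.trans htu).le le_rfl hφ hb,
              bpJacobi_affine η θ (s := s) (t := t) (u := u) hsu]
            ring
  · exact (((measurable_sigmaOn (Or.inl (Set.mem_Iic.2 le_rfl))).const_mul a).add
      ((measurable_sigmaOn (Or.inr (Set.mem_Ici.2 le_rfl))).const_mul b)).aestronglyMeasurable

lemma IsPolyMartingale.condExp_sq [IsProbabilityMeasure μ]
    (h : IsPolyMartingale η θ μ X) {s t u : ℝ≥0} (hst : s < t)
    (htu : t < u) : μ[fun ω => X t ω ^ 2 | outerField X s u] =ᵐ[μ] fun ω =>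
      (((u : ℝ) - t) / (u - s) * X s ω + ((t : ℝ) - s) / (u - s) * X u ω) ^ 2 +
      ((u : ℝ) - t) * (t - s) / u *
            (1 + η * ((u * X s ω - s * X u ω) / (u - s))
              + θ * ((X u ω - X s ω) / (u - s))
              + (X u ω - X s ω) * (s * X u ω - u * X s ω) / ((u : ℝ) - s) ^ 2) := by
  have hle : outerField X s u ≤ mΩ := sigmaOn_le h.measurable _
  have hsu : (u : ℝ) - s ≠ 0 := sub_ne_zero.2 (by exact_mod_cast (hst.trans htu).ne')
  have hu : (u : ℝ) ≠ 0 := by exact_mod_cast (htu.trans_le' (zero_le (a := t))).ne'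
  obtain ⟨r, hr⟩ : ∃ r, r = ((u : ℝ) - t) * (t - s) / u := ⟨_, rfl⟩
  obtain ⟨a, ha⟩ : ∃ a, a = (((u : ℝ) - t) / (u - s)) ^ 2 + r * (u / (u - s) ^ 2) := ⟨_, rfl⟩
  obtain ⟨b, hb'⟩ : ∃ b, b = 2 * (((u : ℝ) - t) / (u - s)) * ((t - s) / (u - s))
    + r * (-(u + s) / (u - s) ^ 2) := ⟨_, rfl⟩
  obtain ⟨c, hc⟩ : ∃ c, c = (((t : ℝ) - s) / (u - s)) ^ 2 + r * (s / (u - s) ^ 2) := ⟨_, rfl⟩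
  obtain ⟨d, hd⟩ : ∃ d, d = r * ((η * u - θ) / (u - s)) := ⟨_, rfl⟩
  obtain ⟨e, he⟩ : ∃ e, e = r * ((θ - η * s) / (u - s)) := ⟨_, rfl⟩
  have hform : ∀ x z : ℝ, (((u : ℝ) - t) / (u - s) * x + ((t : ℝ) - s) / (u - s) * z) ^ 2 +
      r * (1 + η * ((u * x - s * z) / (u - s)) + θ * ((z - x) / (u - s))
              + (z - x) * (s * z - u * x) / ((u : ℝ) - s) ^ 2) =
      a * (x * x) + (b * (x * z) + (c * (z * z) + (d * x + (e * z + r)))) := by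
    intro x z
    rw [ha, hb', hc, hd, he]
    field_simp
    ring
  simp only [← hr, hform]
  have bs := h.isBdd s
  have bt := h.isBdd t
  have bu := h.isBdd u
  have hquad : IsBdd μ fun ω => a * (X s ω * X s ω) + (b * (X s ω * X u ω) +
      (c * (X u ω * X u ω) + (d * X s ω + (e * X u ω + r)))) :=
    ((bs.mul bs).const_mul a).add (((bs.mul bu).const_mul b).add (((bu.mul bu).const_mul c).add
      ((bs.const_mul d).add ((bu.const_mul e).add (isBdd_const r)))))
  have hmeas : ∀ {m : MeasurableSpace Ω}, Measurable[m] (X s) → Measurable[m] (X u) →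
      Measurable[m] fun ω => a * (X s ω * X s ω) + (b * (X s ω * X u ω) +
        (c * (X u ω * X u ω) + (d * X s ω + (e * X u ω + r)))) := by
    intro m hs hu
    fun_prop
  have hXs : Measurable[pastField X u] (X s) := measurable_sigmaOn (hst.trans htu).le
  have hXt : Measurable[pastField X u] (X t) := measurable_sigmaOn htu.le
  have hXu : Measurable[pastField X u] (X u) := measurable_sigmaOn (Set.mem_Iic.2 le_rfl)
  refine (ae_eq_condExp_of_forall_setIntegral_eq hle (bt.pow 2).integrable
    (fun _ _ _ => hquad.integrable.integrableOn) (fun S hS _ => ?_) ?_).symm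
  · have key := h.setIntegral_outerField_eq_zero (hst.trans htu).le
      (Z := fun ω => X t ω ^ 2 + (-1) * (a * (X s ω * X s ω) + (b * (X s ω * X u ω) +
        (c * (X u ω * X u ω) + (d * X s ω + (e * X u ω + r))))))
      ((hXt.pow_const 2).add ((hmeas hXs hXu).const_mul _))
      ((bt.pow 2).add (hquad.const_mul _)) ?_ hS
    · rw [integral_add (bt.pow 2).integrable.integrableOn
        (hquad.const_mul _).integrable.integrableOn, integral_const_mul] at key
      linarith
    · intro φ hφ hb n
      obtain ⟨M, hM⟩ : ∃ M : Ω → ℝ, M = fun ω => (bpM η θ u n).eval (X u ω) := ⟨_, rfl⟩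
      have bM : IsBdd μ M := hM ▸ bu.polynomial_eval _
      have i0 : Integrable (fun ω => φ ω * M ω) μ := (hb.mul bM).integrable
      have i1 : ∀ v, Integrable (fun ω => φ ω * X v ω * M ω) μ := fun v =>
        ((hb.mul (h.isBdd v)).mul bM).integrable
      have i2 : ∀ v w, Integrable (fun ω => φ ω * (X v ω * X w ω) * M ω) μ := fun v w =>
        ((hb.mul ((h.isBdd v).mul (h.isBdd w))).mul bM).integrable
      have e0 := h.integral_mul_bpM (hst.trans htu).le hφ hb n
      have e1 := fun v (h1 : s ≤ v) (h2 : v ≤ u) => h.integral_mul_coord h1 h2 hφ hb n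
      have e2 := fun v w (h1 : s ≤ v) (h2 : v ≤ w) (h3 : w ≤ u) =>
        h.integral_mul_coord_mul_coord h1 h2 h3 hφ hb n
      have hM' : ∀ ω, (bpM η θ u n).eval (X u ω) = M ω := fun ω => by rw [hM]
      simp only [hM'] at e0 e1 e2 ⊢
      calc ∫ ω, φ ω * (X t ω ^ 2 + (-1) * (a * (X s ω * X s ω) + (b * (X s ω * X u ω) +
              (c * (X u ω * X u ω) + (d * X s ω + (e * X u ω + r)))))) * M ω ∂μ
          = ∫ ω, (φ ω * (X t ω * X t ω) * M ω - (a * (φ ω * (X s ω * X s ω) * M ω) +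
              (b * (φ ω * (X s ω * X u ω) * M ω) + (c * (φ ω * (X u ω * X u ω) * M ω) +
              (d * (φ ω * X s ω * M ω) + (e * (φ ω * X u ω * M ω) + r * (φ ω * M ω))))))) ∂μ := by
            congr 1; ext ω; ring
        _ = 0 := by
            have j0 := i0.const_mul r
            have j1 := ((i1 u).const_mul e).fun_add j0
            have j2 := ((i1 s).const_mul d).fun_add j1
            have j3 := ((i2 u u).const_mul c).fun_add j2
            have j4 := ((i2 s u).const_mul b).fun_add j3
            have j5 := ((i2 s s).const_mul a).fun_add j4
            rw [integral_sub (i2 t t) j5, integral_add ((i2 s s).const_mul a) j4,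
              integral_add ((i2 s u).const_mul b) j3, integral_add ((i2 u u).const_mul c) j2,
              integral_add ((i1 s).const_mul d) j1, integral_add ((i1 u).const_mul e) j0]
            simp only [integral_const_mul]
            rw [e0, e1 s le_rfl (hst.trans htu).le, e1 u (hst.trans htu).le le_rfl,
              e2 s s le_rfl le_rfl (hst.trans htu).le, e2 s u le_rfl (hst.trans htu).le le_rfl,
              e2 u u (hst.trans htu).le le_rfl le_rfl, e2 t t hst.le le_rfl htu.le,
              bpJacobi_quadratic η θ (s := s) (t := t) (u := u) hu hsu, ha, hb', hc, hd, he, hr]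
            ring
  · exact (hmeas (measurable_sigmaOn (Or.inl (Set.mem_Iic.2 le_rfl)))
      (measurable_sigmaOn (Or.inr (Set.mem_Ici.2 le_rfl)))).aestronglyMeasurable

lemma IsPolyMartingale.integral_coord [IsProbabilityMeasure μ]
    (h : IsPolyMartingale η θ μ X) (t : ℝ≥0) :
    ∫ ω, X t ω ∂μ = 0 := by
  have := h.integral_mul_bpM (zero_le (a := t)) (φ := fun _ => 1) measurable_const (isBdd_const 1) 1
  simp only [bpQ_one, map_zero, sub_zero, eval_X, one_mul] at this
  rw [this, integral_eq_zero_of_ae h.start]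

lemma IsPolyMartingale.integral_coord_mul_coord [IsProbabilityMeasure μ]
    (h : IsPolyMartingale η θ μ X) {s t : ℝ≥0}
    (hst : s ≤ t) : ∫ ω, X s ω * X t ω ∂μ = s := by
  have e := h.integral_mul_coord_mul_coord (zero_le (a := s)) hst le_rfl (φ := fun _ => 1)
    measurable_const (isBdd_const 1) 0
  have hM : ∀ k, ∫ ω, (1 : ℝ) * (bpM η θ (0 : ℝ≥0) k).eval (X 0 ω) ∂μ =
      (bpM η θ 0 k).eval 0 := by
    intro k
    rw [integral_congr_ae (g := fun _ => (bpM η θ 0 k).eval 0)]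
    · simp
    · filter_upwards [h.start] with ω hω
      simp [hω]
  simp only [hM] at e
  simp only [bpQ_zero, eval_one, mul_one, one_mul, bpJacobi] at e
  rw [e]
  simp [bpQ_one, bpQ_two]

end Harness

/-! ### Existence of the process -/

section Existence

open ProbabilityTheory Filter Topology
open scoped BoundedContinuousFunction

variable {η θ : ℝ}

/-- A bounded variable whose martingale polynomials have the right expectations has the law
`P_{0,t}(0, ·)` of `X_t`. -/
lemma map_eq_bpTransition {Ω : Type*} [MeasurableSpace Ω] {μ : Measure Ω} [IsProbabilityMeasure μ]
    (hηθ : 0 ≤ 1 + η * θ) {t : ℝ} (ht : 0 < t) {Y : Ω → ℝ} (hY : Measurable Y) {R : ℝ}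
    (hR : ∀ᵐ ω ∂μ, |Y ω| ≤ R)
    (h : ∀ n, ∫ ω, (bpM η θ t n).eval (Y ω) ∂μ = (bpM η θ 0 n).eval 0) :
    μ.map Y = bpTransition η θ 0 t 0 := by
  have hd : (0 : ℝ) ≤ 1 + 0 * η := by simp
  obtain ⟨hP, horth⟩ := bpTransition_spec (η := η) hηθ le_rfl ht hd
  have := Measure.isProbabilityMeasure_map (μ := μ) hY.aemeasurable
  refine measure_eq_of_integral_bpQ η θ 0 t 0 (R := R)
    ((ae_map_iff hY.aemeasurable (p := fun y => |y| ≤ R)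
      (measurableSet_le (by fun_prop) measurable_const)).2 hR) horth.integrable_pow fun n => ?_
  rw [integral_map hY.aemeasurable (Polynomial.continuous _).aestronglyMeasurable, h n,
    integral_bpTransition_bpM hηθ le_rfl ht hd]

/-- It suffices to test the martingale property on monomials in the coordinates. The domain
condition then follows, as it is a property of the law of `X_t`. -/
lemma isPolyMartingale_of_monomials {Ω : Type*} [MeasurableSpace Ω] {μ : Measure Ω}
    [IsProbabilityMeasure μ] (hηθ : 0 ≤ 1 + η * θ) {X : ℝ≥0 → Ω → ℝ}
    (hX : ∀ t, Measurable (X t)) (hb : ∀ t, ∃ R, ∀ᵐ ω ∂μ, |X t ω| ≤ R)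
    (h0 : ∀ᵐ ω ∂μ, X 0 ω = 0)
    (h : ∀ s t : ℝ≥0, s < t → ∀ m : ℝ≥0 →₀ ℕ, (m.support : Set ℝ≥0) ⊆ Set.Iic s → ∀ n,
      ∫ ω, coordMonomial X m ω * (bpM η θ t n).eval (X t ω) ∂μ =
        ∫ ω, coordMonomial X m ω * (bpM η θ s n).eval (X s ω) ∂μ) :
    IsPolyMartingale η θ μ X where
  measurable := hX
  bounded := hb
  start := h0
  domain t := by
    rcases eq_or_lt_of_le (zero_le (a := t)) with rfl | ht
    · filter_upwards [h0] with ω hω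
      simp [hω]
    · obtain ⟨R, hR⟩ := hb t
      have hlaw := map_eq_bpTransition (μ := μ) hηθ (NNReal.coe_pos.2 ht) (hX t) hR fun n => by
        have := h 0 t ht 0 (by simp) n
        simp only [coordMonomial_zero, one_mul] at this
        rw [this, integral_congr_ae (g := fun _ => (bpM η θ 0 n).eval 0)]
        · simp
        · filter_upwards [h0] with ω hω
          simp [hω]
      have hsupp := (bpTransition_support (η := η) (x := 0) hηθ le_rfl (NNReal.coe_pos.2 ht)
        (by simp)).1
      rw [← hlaw] at hsupp
      exact ae_of_ae_map (hX t).aemeasurable hsupp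
  martingale s t hst n S hS := by
    have hXb : ∀ t, IsBdd μ (X t) := fun t => ⟨(hX t).aestronglyMeasurable, hb t⟩
    have bt := (hXb t).polynomial_eval (bpM η θ t n)
    have bs := (hXb s).polynomial_eval (bpM η θ s n)
    rw [← sub_eq_zero, ← integral_sub bt.integrable.integrableOn bs.integrable.integrableOn]
    refine setIntegral_sigmaOn_eq_zero hX hb (bt.integrable.sub bs.integrable) (fun m hm => ?_) hS
    have bm : IsBdd μ (coordMonomial X m) :=
      ⟨((measurable_coordMonomial hm).mono (sigmaOn_le hX _) le_rfl).aestronglyMeasurable,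
        coordMonomial_bounded hb m⟩
    rw [← sub_eq_zero.2 (h s t hst m hm n),
      ← integral_sub (bm.mul bt).integrable (bm.mul bs).integrable]
    congr 1
    ext ω
    simp only [Pi.sub_apply]
    ring

/-- Markov chains with the transition probabilities `P_{s,t}` along finitely many times, built by
adding the largest time last. -/
lemma exists_finite_chain (hηθ : 0 ≤ 1 + η * θ) (F : Finset ℝ≥0) (hF : ∀ i ∈ F, 0 < i) :
    ∃ (Ω : Type) (_ : MeasurableSpace Ω) (μ : Measure Ω) (X : ℝ≥0 → Ω → ℝ),
      IsProbabilityMeasure μ ∧ (∀ t, Measurable (X t)) ∧ (∀ t, ∃ R, ∀ᵐ ω ∂μ, |X t ω| ≤ R) ∧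
      (∀ t, ∀ᵐ ω ∂μ, 0 ≤ 1 + X t ω * η) ∧ (∀ ω, X 0 ω = 0) ∧
      ∀ s ∈ insert 0 F, ∀ t ∈ insert 0 F, s < t → ∀ m : ℝ≥0 →₀ ℕ,
        (m.support : Set ℝ≥0) ⊆ Set.Iic s → ∀ n,
        ∫ ω, coordMonomial X m ω * (bpM η θ t n).eval (X t ω) ∂μ =
          ∫ ω, coordMonomial X m ω * (bpM η θ s n).eval (X s ω) ∂μ := by
  induction F using Finset.induction_on_max with
  | empty =>
    refine ⟨Unit, inferInstance, Measure.dirac (), fun _ _ => 0, inferInstance,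
      fun _ => measurable_const, fun _ => ⟨0, by simp⟩, fun _ => by simp, fun _ => rfl, ?_⟩
    intro s hs t ht hst
    simp only [insert_empty_eq, Finset.mem_singleton] at hs ht
    exact absurd hst (by simp [hs, ht])
  | insert a F ha ih =>
    obtain ⟨Ω, mΩ, μ, X, hμ, hX, hb, hd, h0, hmart⟩ :=
      ih fun i hi => hF i (Finset.mem_insert_of_mem hi)
    have ha0 : 0 < a := hF a (Finset.mem_insert_self a F)
    obtain ⟨m, hm, hmax⟩ : ∃ m ∈ insert 0 F, ∀ i ∈ insert 0 F, i ≤ m :=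
      ⟨_, Finset.max'_mem _ (Finset.insert_nonempty 0 F), fun i hi => Finset.le_max' _ i hi⟩
    have hma : m < a := by
      rcases Finset.mem_insert.1 hm with rfl | hm
      exacts [ha0, ha m hm]
    obtain ⟨κ, hκm, hκ⟩ := exists_transitionKernel (η := η) (θ := θ) hηθ m.2
      (NNReal.coe_lt_coe.2 hma)
    obtain ⟨k, hk⟩ := hb m
    obtain ⟨R, -, hR⟩ := exists_uniform_support_bound (η := η) hηθ m.2
      (NNReal.coe_lt_coe.2 hma) k
    let μ' : Measure (Ω × ℝ) := μ ⊗ₘ (κ.comap (X m) (hX m))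
    let X' : ℝ≥0 → Ω × ℝ → ℝ := fun t p => if t = a then p.2 else X t p.1
    have hX'a : ∀ p, X' a p = p.2 := fun p => if_pos rfl
    have hX' : ∀ t, t ≠ a → ∀ p, X' t p = X t p.1 := fun t ht p => if_neg ht
    have hfst : ∀ {P : Ω → Prop}, (∀ᵐ ω ∂μ, P ω) → ∀ᵐ p ∂μ', P p.1 := by
      intro P hP
      have : μ'.map Prod.fst = μ := Measure.fst_compProd μ _
      rw [← this] at hP
      exact ae_of_ae_map measurable_fst.aemeasurable hP
    have hsnd : ∀ {P : ℝ → Prop}, MeasurableSet {y | P y} →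
        (∀ᵐ ω ∂μ, ∀ᵐ y ∂(κ (X m ω)), P y) → ∀ᵐ p ∂μ', P p.2 := fun hP h =>
      (Measure.ae_compProd_iff (measurable_snd hP)).2 h
    have hb' : ∀ᵐ p ∂μ', |p.2| ≤ R := by
      refine hsnd (P := fun y => |y| ≤ R) (measurableSet_le (by fun_prop) measurable_const) ?_
      filter_upwards [hk, hd m] with ω h1 h2
      rw [hκ _ h2]
      exact hR _ h1 h2
    have hd' : ∀ᵐ p ∂μ', 0 ≤ 1 + p.2 * η := by
      refine hsnd (P := fun y => 0 ≤ 1 + y * η)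
        (measurableSet_le measurable_const (by fun_prop)) ?_
      filter_upwards [hd m] with ω h2
      rw [hκ _ h2]
      exact (bpTransition_support hηθ m.2 (NNReal.coe_lt_coe.2 hma) h2).1
    have hXb : ∀ t, IsBdd μ (X t) := fun t => ⟨(hX t).aestronglyMeasurable, hb t⟩
    have bmon : ∀ j, Measurable (coordMonomial X j) ∧ IsBdd μ (coordMonomial X j) := fun j =>
      ⟨(measurable_coordMonomial (Set.subset_univ _)).mono (sigmaOn_le hX _) le_rfl,
        ((measurable_coordMonomial (Set.subset_univ _)).mono
        (sigmaOn_le hX _) le_rfl).aestronglyMeasurable, coordMonomial_bounded hb j⟩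
    have hint_fst : ∀ G : Ω → ℝ, AEStronglyMeasurable G μ → ∫ p, G p.1 ∂μ' = ∫ ω, G ω ∂μ := by
      intro G hG
      have : μ'.map Prod.fst = μ := Measure.fst_compProd μ _
      rw [← this] at hG
      rw [← integral_map measurable_fst.aemeasurable hG, this]
    have hint_last : ∀ j n, ∫ p, coordMonomial X j p.1 * (bpM η θ a n).eval p.2 ∂μ' =
        ∫ ω, coordMonomial X j ω * (bpM η θ m n).eval (X m ω) ∂μ := by
      intro j n
      have b2 : IsBdd μ' fun p => p.2 := ⟨measurable_snd.aestronglyMeasurable, R, hb'⟩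
      have b1 : IsBdd μ' fun p => coordMonomial X j p.1 := by
        obtain ⟨C, hC⟩ := (bmon j).2.2
        exact ⟨((bmon j).1.comp measurable_fst).aestronglyMeasurable, C, hfst hC⟩
      rw [Measure.integral_compProd (b1.mul (b2.polynomial_eval _)).integrable]
      refine integral_congr_ae ?_
      filter_upwards [hd m] with ω h2
      rw [integral_const_mul, Kernel.comap_apply, hκ _ h2,
        integral_bpTransition_bpM hηθ m.2 (NNReal.coe_lt_coe.2 hma) h2]
      rfl
    refine ⟨Ω × ℝ, Prod.instMeasurableSpace, μ', X', inferInstance, fun t => ?_, fun t => ?_,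
      fun t => ?_, fun p => ?_, ?_⟩
    · by_cases hta : t = a
      · simpa only [X', if_pos hta] using measurable_snd
      · rw [show X' t = fun p => X t p.1 from funext (hX' t hta)]
        exact (hX t).comp measurable_fst
    · by_cases hta : t = a
      · subst hta
        exact ⟨R, by simpa only [hX'a] using hb'⟩
      · obtain ⟨C, hC⟩ := hb t
        exact ⟨C, by simpa only [hX' t hta] using hfst hC⟩
    · by_cases hta : t = a
      · subst hta
        simpa only [hX'a] using hd'
      · simpa only [hX' t hta] using hfst (hd t)
    · rw [hX' 0 ha0.ne, h0]
    · intro s hs t ht hst j hj n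
      have hle : ∀ i ∈ insert 0 (insert a F), i ≤ a := by
        intro i hi
        rcases Finset.mem_insert.1 hi with rfl | hi
        · exact zero_le
        · rcases Finset.mem_insert.1 hi with rfl | hi
          exacts [le_rfl, (ha i hi).le]
      have hsa : s < a := hst.trans_le (hle t ht)
      have hmem : ∀ i ∈ insert 0 (insert a F), i ≠ a → i ∈ insert 0 F := by
        intro i hi hia
        simp only [Finset.mem_insert] at hi ⊢
        tauto
      have hsF := hmem s hs hsa.ne
      have hmono : ∀ p, coordMonomial X' j p = coordMonomial X j p.1 := by
        intro p
        refine Finset.prod_congr rfl fun i hi => ?_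
        have : i ≤ s := hj hi
        simp only [hX' i (this.trans_lt hsa).ne]
      have hpast : ∀ r, r ≠ a → ∫ p, coordMonomial X' j p * (bpM η θ r n).eval (X' r p) ∂μ' =
          ∫ ω, coordMonomial X j ω * (bpM η θ r n).eval (X r ω) ∂μ := by
        intro r hr
        simp only [hmono, hX' r hr]
        exact hint_fst (fun ω => coordMonomial X j ω * (bpM η θ r n).eval (X r ω))
          ((bmon j).2.mul ((hXb r).polynomial_eval _)).1
      rw [hpast s hsa.ne]
      by_cases hta : t = a
      · subst hta
        simp only [hmono, hX'a]
        rw [hint_last]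
        rcases eq_or_lt_of_le (hmax s hsF) with rfl | hsm
        · rfl
        · exact hmart s hsF m hm hsm j hj n
      · rw [hpast t hta]
        exact hmart s hsF t (hmem t ht hta) hst j hj n

/-- The compact space of paths with `|X_t| ≤ R_t`, with the product topology. -/
def BoundedPaths (R : ℝ≥0 → ℝ) : Type := ∀ t, Set.Icc (-R t) (R t)

instance (R : ℝ≥0 → ℝ) : TopologicalSpace (BoundedPaths R) :=
  inferInstanceAs (TopologicalSpace (∀ t, Set.Icc (-R t) (R t)))

instance (R : ℝ≥0 → ℝ) : CompactSpace (BoundedPaths R) :=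
  inferInstanceAs (CompactSpace (∀ t, Set.Icc (-R t) (R t)))

instance (R : ℝ≥0 → ℝ) : T2Space (BoundedPaths R) :=
  inferInstanceAs (T2Space (∀ t, Set.Icc (-R t) (R t)))

/-- The Borel `σ`-algebra, which is larger than the product `σ`-algebra. -/
instance (R : ℝ≥0 → ℝ) : MeasurableSpace (BoundedPaths R) := borel _

instance (R : ℝ≥0 → ℝ) : BorelSpace (BoundedPaths R) := ⟨rfl⟩

/-- The coordinate process on `BoundedPaths R`. -/
def pathCoord (R : ℝ≥0 → ℝ) (t : ℝ≥0) (w : BoundedPaths R) : ℝ := (w t : ℝ)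

lemma continuous_pathCoord (R : ℝ≥0 → ℝ) (t : ℝ≥0) : Continuous (pathCoord R t) :=
  continuous_subtype_val.comp (continuous_apply t)

lemma abs_pathCoord_le (R : ℝ≥0 → ℝ) (t : ℝ≥0) (w : BoundedPaths R) : |pathCoord R t w| ≤ R t :=
  abs_le.2 (w t).2

lemma continuous_coordMonomial_pathCoord (R : ℝ≥0 → ℝ) (m : ℝ≥0 →₀ ℕ) :
    Continuous (coordMonomial (pathCoord R) m) := by
  unfold coordMonomial Finsupp.prod
  exact continuous_finsetProd _ fun i _ => (continuous_pathCoord R i).pow _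

/-- The finite chains as laws on one compact path space. -/
lemma exists_finite_chain_on_paths (hηθ : 0 ≤ 1 + η * θ) {R : ℝ≥0 → ℝ} (hR0 : R 0 = 0)
    (hRnonneg : ∀ t, 0 ≤ R t)
    (hR : ∀ t : ℝ≥0, 0 < t → ∀ᵐ y ∂(bpTransition η θ 0 t 0), |y| ≤ R t) (F : Finset ℝ≥0) :
    ∃ P : ProbabilityMeasure (BoundedPaths R), ∀ s ∈ insert 0 F, ∀ t ∈ insert 0 F, s < t →
      ∀ m : ℝ≥0 →₀ ℕ, (m.support : Set ℝ≥0) ⊆ Set.Iic s → m.support ⊆ insert 0 F → ∀ n,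
        ∫ w, coordMonomial (pathCoord R) m w * (bpM η θ t n).eval (pathCoord R t w) ∂P =
          ∫ w, coordMonomial (pathCoord R) m w * (bpM η θ s n).eval (pathCoord R s w) ∂P := by
  classical
  obtain ⟨Ω, mΩ, μ, X, hμ, hX, hb, -, h0, hmart⟩ :=
    exists_finite_chain (η := η) hηθ (F.filter (0 < ·)) (fun i hi => (Finset.mem_filter.1 hi).2)
  have hF' : ∀ i ∈ insert 0 F, i ∈ insert 0 (F.filter (0 < ·)) := by
    intro i hi
    rcases Finset.mem_insert.1 hi with rfl | hi
    · simp
    · rcases eq_or_lt_of_le (zero_le (a := i)) with rfl | hpos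
      · simp
      · exact Finset.mem_insert_of_mem (Finset.mem_filter.2 ⟨hi, hpos⟩)
  have hbound : ∀ i ∈ insert 0 F, ∀ᵐ ω ∂μ, |X i ω| ≤ R i := by
    intro i hi
    rcases eq_or_lt_of_le (zero_le (a := i)) with rfl | hpos
    · simp [h0, hR0]
    · obtain ⟨C, hC⟩ := hb i
      have hlaw := map_eq_bpTransition (μ := μ) hηθ (NNReal.coe_pos.2 hpos) (hX i) hC fun n => by
        have := hmart 0 (by simp) i (hF' i hi) hpos 0 (by simp) n
        simpa [coordMonomial_zero, h0] using this
      have hsupp := hR i hpos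
      rw [← hlaw] at hsupp
      exact ae_of_ae_map (hX i).aemeasurable hsupp
  let I : Finset ℝ≥0 := insert 0 F
  let e : (I → ℝ) → BoundedPaths R := fun v t =>
    Set.projIcc (-R t) (R t) (by linarith [hRnonneg t]) (if h : t ∈ I then v ⟨t, h⟩ else 0)
  have he : Continuous e := by
    refine continuous_pi fun t => continuous_projIcc.comp ?_
    by_cases h : t ∈ I
    · simp only [dif_pos h]; exact continuous_apply _
    · simp only [dif_neg h]; exact continuous_const
  let Y : Ω → BoundedPaths R := fun ω => e fun i => X i ω
  have hY : Measurable Y := he.measurable.comp (measurable_pi_lambda _ fun i => hX i)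
  have hcoord : ∀ᵐ ω ∂μ, ∀ i ∈ I, pathCoord R i (Y ω) = X i ω := by
    rw [Filter.eventually_all_finset]
    intro i hi
    filter_upwards [hbound i hi] with ω hω
    have := Set.projIcc_of_mem (a := -R i) (b := R i) (by linarith [hRnonneg i]) (abs_le.1 hω)
    simp only [pathCoord, Y, e, dif_pos hi, this]
  refine ⟨⟨μ.map Y, Measure.isProbabilityMeasure_map hY.aemeasurable⟩, ?_⟩
  intro s hs t ht hst m hm hmF n
  have htransfer : ∀ r ∈ I,
      ∫ w, coordMonomial (pathCoord R) m w * (bpM η θ r n).eval (pathCoord R r w) ∂(μ.map Y) =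
        ∫ ω, coordMonomial X m ω * (bpM η θ r n).eval (X r ω) ∂μ := by
    intro r hr
    have hc : Continuous fun w : BoundedPaths R =>
        coordMonomial (pathCoord R) m w * (bpM η θ r n).eval (pathCoord R r w) :=
      (continuous_coordMonomial_pathCoord R m).mul
        ((Polynomial.continuous _).comp (continuous_pathCoord R r))
    rw [integral_map hY.aemeasurable hc.measurable.aestronglyMeasurable]
    refine integral_congr_ae ?_
    filter_upwards [hcoord] with ω hω
    have : coordMonomial (pathCoord R) m (Y ω) = coordMonomial X m ω :=
      Finset.prod_congr rfl fun i hi => by simp only [hω i (hmF hi)]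
    rw [this, hω r hr]
  rw [ProbabilityMeasure.coe_mk, htransfer t ht, htransfer s hs]
  exact hmart s (hF' s hs) t (hF' t ht) hst m hm n

/-- The process exists: its law is a limit of the laws of the finite chains along an ultrafilter on
the finite sets of times. -/
lemma exists_isFreeBiPoisson (hηθ : 0 ≤ 1 + η * θ) :
    ∃ (Ω : Type) (_ : MeasurableSpace Ω) (μ : Measure Ω) (X : ℝ≥0 → Ω → ℝ),
      IsProbabilityMeasure μ ∧ IsFreeBiPoisson η θ μ X := by
  classical
  have hex : ∀ t : ℝ≥0, ∃ R : ℝ, 0 ≤ R ∧ (t = 0 → R = 0) ∧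
      (0 < t → ∀ᵐ y ∂(bpTransition η θ 0 t 0), |y| ≤ R) := by
    intro t
    rcases eq_or_lt_of_le (zero_le (a := t)) with rfl | ht
    · exact ⟨0, le_rfl, fun _ => rfl, fun h => absurd h (lt_irrefl _)⟩
    · exact ⟨_, norm_nonneg _, fun h => absurd h ht.ne', fun _ =>
        (bpTransition_support (η := η) (x := 0) hηθ le_rfl (NNReal.coe_pos.2 ht) (by simp)).2⟩
  choose R hRnonneg hR0 hR using hex
  choose P hP using exists_finite_chain_on_paths hηθ (hR0 0 rfl) hRnonneg hR
  let U : Ultrafilter (Finset ℝ≥0) := Ultrafilter.of atTop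
  have hU : (U : Filter (Finset ℝ≥0)) ≤ atTop := Ultrafilter.of_le _
  let ν : ProbabilityMeasure (BoundedPaths R) := (U.map P).lim
  have hν : Tendsto P U (𝓝 ν) := (U.map P).le_nhds_lim
  refine ⟨BoundedPaths R, inferInstance, ν, pathCoord R, inferInstance, ?_⟩
  refine (isPolyMartingale_of_monomials hηθ (fun t => (continuous_pathCoord R t).measurable)
    (fun t => ⟨R t, Eventually.of_forall (abs_pathCoord_le R t)⟩)
    (Eventually.of_forall fun w => ?_) ?_).isFreeBiPoisson hηθ
  · have := abs_pathCoord_le R 0 w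
    rw [hR0 0 rfl] at this
    exact abs_nonpos_iff.1 this
  · intro s t hst m hm n
    have hlim : ∀ r : ℝ≥0, Tendsto (fun F => ∫ w, coordMonomial (pathCoord R) m w *
        (bpM η θ r n).eval (pathCoord R r w) ∂(P F : Measure (BoundedPaths R))) U
        (𝓝 (∫ w, coordMonomial (pathCoord R) m w *
          (bpM η θ r n).eval (pathCoord R r w) ∂(ν : Measure (BoundedPaths R)))) := by
      intro r
      exact ProbabilityMeasure.tendsto_iff_forall_integral_tendsto.1 hν
        (BoundedContinuousFunction.mkOfCompact ⟨_, (continuous_coordMonomial_pathCoord R m).mul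
          ((Polynomial.continuous (bpM η θ r n)).comp (continuous_pathCoord R r))⟩)
    refine tendsto_nhds_unique (hlim t) ((hlim s).congr' ?_)
    refine hU ?_
    filter_upwards [eventually_ge_atTop (insert s (insert t m.support))] with F hF
    refine (hP F s ?_ t ?_ hst m hm ?_ n).symm
    · exact Finset.mem_insert_of_mem (hF (by simp))
    · exact Finset.mem_insert_of_mem (hF (by simp))
    · intro i hi
      exact Finset.mem_insert_of_mem
        (hF (by simp [Finset.mem_insert, Finsupp.mem_support_iff.1 hi]))

end Existence

theorem theorem2p4 (η θ : ℝ) (hηθ : 0 ≤ 1 + η * θ) :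
    -- the transition probabilities are well defined
    (∀ s t x : ℝ, 0 ≤ s → s < t → 0 ≤ 1 + x * η →
      ∃! ν : Measure ℝ, IsProbabilityMeasure ν ∧ MakesOrthogonal (bpQ η θ s t x) ν) ∧
    -- the Markov process exists
    (∃ (Ω : Type) (_ : MeasurableSpace Ω) (μ : Measure Ω) (X : ℝ≥0 → Ω → ℝ),
      IsProbabilityMeasure μ ∧ IsFreeBiPoisson η θ μ X) ∧
    -- every such process solves the problem
    (∀ (Ω : Type*) [MeasurableSpace Ω] (μ : Measure Ω) [IsProbabilityMeasure μ]
      (X : ℝ≥0 → Ω → ℝ), IsFreeBiPoisson η θ μ X →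
      (∀ t, MemLp (X t) 2 μ) ∧
      (∀ t, ∫ ω, X t ω ∂μ = 0) ∧
      (∀ t s, ∫ ω, X t ω * X s ω ∂μ = min (t : ℝ) (s : ℝ)) ∧
      (∀ s t u : ℝ≥0, s < t → t < u →
        μ[X t | outerField X s u] =ᵐ[μ] fun ω =>
          ((u : ℝ) - t) / (u - s) * X s ω + ((t : ℝ) - s) / (u - s) * X u ω) ∧
      (∀ s t u : ℝ≥0, s < t → t < u →
        (fun ω => (μ[fun ω' => X t ω' ^ 2 | outerField X s u]) ω
            - (μ[X t | outerField X s u]) ω ^ 2) =ᵐ[μ] fun ω =>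
          ((u : ℝ) - t) * (t - s) / u *
            (1 + η * ((u * X s ω - s * X u ω) / (u - s))
              + θ * ((X u ω - X s ω) / (u - s))
              + (X u ω - X s ω) * (s * X u ω - u * X s ω) / ((u : ℝ) - s) ^ 2))) := by
  refine ⟨fun s t x hs hst hx => existsUnique_makesOrthogonal hηθ hs hst hx,
    exists_isFreeBiPoisson hηθ, ?_⟩
  intro Ω _ μ _ X h
  have hm := h.isPolyMartingale hηθ
  refine ⟨fun t => ?_, hm.integral_coord, fun t s => ?_,
    fun s t u hst htu => hm.condExp_linear hst htu, fun s t u hst htu => ?_⟩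
  · obtain ⟨h1, C, hC⟩ := hm.isBdd t
    exact MemLp.of_bound h1 C hC
  · rcases le_total (t : ℝ) s with hts | hst
    · rw [min_eq_left hts, hm.integral_coord_mul_coord hts]
    · rw [min_eq_right hst, ← hm.integral_coord_mul_coord hst]
      exact integral_congr_ae (.of_forall fun ω => mul_comm _ _)
  · filter_upwards [hm.condExp_linear hst htu, hm.condExp_sq hst htu] with ω h1 h2
    rw [h1, h2]
    ring
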